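/- **Setting.** There are $K$ arms; arm $i$ has a reward law $\nu_i$ on $[0,1]$ with mean $\mu_i$, and rewards are independent over rounds and arms. In each round $t=0,1,\dots,T-1$ every player who is present chooses an arm; a player *collides* if another present player chooses the same arm, and then receives no reward. With $N_t$ the number of players present in round $t$, the regret is $$R=\sum_{t<T}\Big(\sum_{k\text{ among the }N_t\text{ best arms}}\mu_k-\sum_{j\text{ present}}\mu_{j}(t)\,(1-\eta_j(t))\Big),$$ where $\mu_j(t)$ is the mean of the arm chosen by player $j$ and $\eta_j(t)\in\{0,1\}$ indicates a collision of $j$. *Scenario:* with $L=\lceil T^\lambda\rceil$, $0<\lambda<1$, one player leaves at each of the rounds $2rL$, one player enters at each of the rounds $(2r+1)L$ ($r=0,1,2,\dots$, rounds below $T$), and the set of players does not change otherwise. **DMC algorithm.** Time is divided into epochs of $T_1$ rounds. A player present from the start of an epoch chooses arms uniformly at random for the first $T_0$ rounds. From her $C$ collisions in these rounds she computes $N^*=\mathrm{round}\big(\log(\tfrac{T_0-C}{T_0})/\log(1-\tfrac1K)+1\big)$ ($N^*=K$ if $C=T_0$), and she sorts the arms by their empirical means over her collision-free observations. Then in each round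 she chooses uniformly one of her $N^*$ best-ranked arms (with $N^*$ truncated to at most $K$), until she chooses an arm without a collision; she stays on that arm until the epoch ends. A player who enters during an epoch chooses arms uniformly at random until the next epoch. The parameters, for given $\epsilon>0$ and $\delta\in(0,1)$, are $$T_0=\Big\lceil\max\Big(\tfrac K2\ln\tfrac{2K^2}{\delta/(2T)},\ \tfrac{16K}{\epsilon^2}\ln\tfrac{4K^2}{\delta/(2T)},\ \tfrac{K^2\ln(4T/\delta)}{0.02}\Big)\Big\rceil,\qquad T_1=\max\Big(\Big\lceil\sqrt{T(T_0+2e^2K)/x}\Big\rceil,\,T_0+1\Big),$$ with $x=\lceil T/L\rceil$ the number of rounds at which a player leaves or enters. **Theorem.** 1. (MEGA.) Let $\beta\ge 0$ be the unavailability parameter of the MEGA algorithm, and consider its regret upper bound $\min\{T,\ S+\sum_{t}t^\beta\}$, where the sum is over the leaving rounds $t=2rL<T$ (a player leaving at round $t$ contributes $t^\beta$) and $S\ge0$ is the part of the bound due to all other sources of regret. There is a constant $c>0$ depending only on $\beta$ such that, for every $\lambda$ with $\beta<\lambda<1$, all sufficiently large $T$ (depending on $\beta,\lambda$) and every $S\ge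 0$, this upper bound is at least $c\,T^{1-(\lambda-\beta)}$. 2. (DMC.) There are absolute constants $C,a,b$ such that the following holds for every $\lambda\in(0,1)$ (in particular whenever $\lambda>\beta$), all $K$, all reward laws, all $T\ge1$ and every choice of which players leave and enter in the scenario (fixed in advance). Suppose that at most $N_m<K$ players are present in any round, and that the gap between the means of the $i$-th and the $(i+1)$-st best arm exceeds $\epsilon>0$ for $i=1,\dots,N_m$. Let $\delta\in(0,1)$, and let $G$ be the event that in every epoch whose first $T_0$ rounds (the learning rounds) end within the horizon and have one and the same set of present players, every present player obtains $N^*=N_t$ and a ranking that lists arm $i$ before arm $j$ whenever $\mu_i-\mu_j>\epsilon$. Then the DMC algorithm with the parameters above satisfies $\Pr(G)\ge1-\delta$ and $$\mathbb E[R\mid G]\ \le\ C\Big(\frac K\epsilon\Big)^{a}\Big(1+\ln T+\ln\frac1\delta\Big)^{b}\,T^{1-\lambda/2},$$ that is, $\mathbb E[R\mid G]=\tilde O(T^{1-\lambda/2})$. -/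

import Mathlib

open MeasureTheory ProbabilityTheory

namespace MusicalChairs

noncomputable section

/-! # The model

There are `K` arms, labelled by `Fin K`, and a pool of `M` labelled players, `Fin M`.  Rounds are
numbered `0, 1, 2, …`; `act t` is the set of players that are present (active) in round `t`. -/

/-- The arms listed in decreasing order of the values `m`: position `0` carries the best arm. -/
def ranking {K : ℕ} (m : Fin K → ℝ) : Equiv.Perm (Fin K) :=
  Tuple.sort fun i => -m i

/-- The private randomness of one player in one round: coordinate `m` is a number drawn from
`{0, …, m}`.  A player who wants to draw from a set of `n` elements reads coordinate `n - 1`. -/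
abbrev Draw (K : ℕ) : Type := ∀ m : Fin K, Fin ((m : ℕ) + 1)

/-- The randomness of one round: the rewards that the `K` arms offer, and the players' draws. -/
abbrev RoundSeed (K M : ℕ) : Type := (Fin K → ℝ) × (Fin M → Draw K)

/-- In one round, the reward of arm `i` has law `ν i`, the draws are uniform, and all of these are
independent. -/
def roundLaw {K : ℕ} (M : ℕ) (ν : Fin K → Measure ℝ) : Measure (RoundSeed K M) :=
  (Measure.pi ν).prod
    (Measure.pi fun _ : Fin M =>
      Measure.pi fun m : Fin K => (PMF.uniformOfFintype (Fin ((m : ℕ) + 1))).toMeasure)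

instance {K M : ℕ} (ν : Fin K → Measure ℝ) [∀ i, IsProbabilityMeasure (ν i)] :
    IsProbabilityMeasure (roundLaw M ν) := by
  unfold roundLaw
  infer_instance

/-- The rounds are independent and identically distributed. -/
def gameLaw {K : ℕ} (M : ℕ) (ν : Fin K → Measure ℝ) [∀ i, IsProbabilityMeasure (ν i)] :
    Measure (ℕ → RoundSeed K M) :=
  Measure.infinitePi fun _ : ℕ => roundLaw M ν

/-- The mean reward of each arm. -/
def meanReward {K : ℕ} (ν : Fin K → Measure ℝ) (i : Fin K) : ℝ := ∫ x, x ∂(ν i)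

/-- Player `p` collides when the players in `S` choose the arms `a`: another player of `S` chooses
the same arm. -/
abbrev Collides {K M : ℕ} (S : Finset (Fin M)) (a : Fin M → Fin K) (p : Fin M) : Prop :=
  ∃ q ∈ S, q ≠ p ∧ a q = a p

/-- A sorted list `A` of the arms is an `ε`-correct ranking if arm `i` is listed before arm `j`
whenever `μ i - μ j > ε`. -/
def IsCorrectRanking {K : ℕ} (ε : ℝ) (μ : Fin K → ℝ) (A : Equiv.Perm (Fin K)) : Prop :=
  ∀ i j, ε < μ i - μ j → A.symm i < A.symm j

/-- The gap between the `i`-th best arm and the `(i+1)`-st best arm exceeds `ε`, for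
`i = 1, …, Nm`. -/
def GapsExceed {K : ℕ} (ε : ℝ) (Nm : ℕ) (μ : Fin K → ℝ) : Prop :=
  ∀ i : ℕ, i < Nm → ∀ h : i + 1 < K,
    ε < μ (ranking μ ⟨i, Nat.lt_of_succ_lt h⟩) - μ (ranking μ ⟨i + 1, h⟩)

/-! # The Dynamic Musical Chairs algorithm

Parameters: `T₀` is the number of learning rounds at the start of an epoch and `T₁` is the length
of an epoch.  The epochs are the blocks of rounds `m * T₁, …, (m + 1) * T₁ - 1`. -/

section Algorithm

variable {K M : ℕ} [NeZero K]

/-- A (zero-based) uniform index among the first `n` of the `K` positions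
(`n` is truncated to `1 ≤ n ≤ K`). -/
def sampleBelow (d : Draw K) (n : ℕ) : Fin K :=
  Fin.castLE (show min n K - 1 + 1 ≤ K by have := NeZero.pos K; omega)
    (d ⟨min n K - 1, by have := NeZero.pos K; omega⟩)

/-- The uniformly random arm that an exploring player chooses in round `t`. -/
def exploreArm (ω : ℕ → RoundSeed K M) (t : ℕ) (p : Fin M) : Fin K :=
  sampleBelow ((ω t).2 p) K

/-- The number of collisions of `p` in the `T₀` learning rounds that start at round `s`. -/
def collisionCount (T₀ : ℕ) (act : ℕ → Finset (Fin M)) (ω : ℕ → RoundSeed K M) (s : ℕ)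
    (p : Fin M) : ℕ :=
  ∑ t ∈ Finset.Ico s (s + T₀), if Collides (act t) (exploreArm ω t) p then 1 else 0

/-- The number of times that `p` observes arm `i` (without a collision) in these rounds. -/
def observationCount (T₀ : ℕ) (act : ℕ → Finset (Fin M)) (ω : ℕ → RoundSeed K M) (s : ℕ)
    (p : Fin M) (i : Fin K) : ℕ :=
  ∑ t ∈ Finset.Ico s (s + T₀),
    if exploreArm ω t p = i ∧ ¬ Collides (act t) (exploreArm ω t) p then 1 else 0

/-- The sum of the rewards that `p` receives from arm `i` in these rounds. -/
def rewardSum (T₀ : ℕ) (act : ℕ → Finset (Fin M)) (ω : ℕ → RoundSeed K M) (s : ℕ)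
    (p : Fin M) (i : Fin K) : ℝ :=
  ∑ t ∈ Finset.Ico s (s + T₀),
    if exploreArm ω t p = i ∧ ¬ Collides (act t) (exploreArm ω t) p then (ω t).1 i else 0

/-- The empirical mean reward of arm `i` (it is `0` if there is no observation). -/
def empiricalMean (T₀ : ℕ) (act : ℕ → Finset (Fin M)) (ω : ℕ → RoundSeed K M) (s : ℕ)
    (p : Fin M) (i : Fin K) : ℝ :=
  rewardSum T₀ act ω s p i / observationCount T₀ act ω s p i

/-- The sorted list of arms that `p` has learned in these rounds. -/
def learnedRanking (T₀ : ℕ) (act : ℕ → Finset (Fin M)) (ω : ℕ → RoundSeed K M) (s : ℕ)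
    (p : Fin M) : Equiv.Perm (Fin K) :=
  ranking (empiricalMean T₀ act ω s p)

/-- The estimate that `p` computes for the number of players from the number of collisions. -/
def playerEstimate (T₀ : ℕ) (act : ℕ → Finset (Fin M)) (ω : ℕ → RoundSeed K M) (s : ℕ)
    (p : Fin M) : ℕ :=
  if collisionCount T₀ act ω s p = T₀ then K
  else
    (round (Real.log (((T₀ : ℝ) - collisionCount T₀ act ω s p) / T₀) /
      Real.log (1 - 1 / (K : ℝ)) + 1)).toNat

/-- The first round of the epoch of round `t`. -/
def epochStart (T₁ t : ℕ) : ℕ := T₁ * (t / T₁)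

/-- In round `t`, player `p` plays musical chairs: the learning rounds of the epoch are over, and
`p` has been present since the start of the epoch.  (A player who entered later explores until the
end of the epoch.) -/
abbrev InChairs (T₀ T₁ : ℕ) (act : ℕ → Finset (Fin M)) (t : ℕ) (p : Fin M) : Prop :=
  T₀ ≤ t % T₁ ∧ ∀ s ∈ Finset.Icc (epochStart T₁ t) t, p ∈ act s

/-- The arm that `p` chooses in round `t`, when `fixed p` is the arm on which `p` is fixed at that
time (if there is one): an exploring player chooses uniformly among all arms, a fixed player stays,
and a player who is not yet fixed chooses uniformly among the arms she believes to be the best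
ones. -/
def chooseArm (T₀ T₁ : ℕ) (act : ℕ → Finset (Fin M)) (ω : ℕ → RoundSeed K M) (t : ℕ)
    (fixed : Fin M → Option (Fin K)) (p : Fin M) : Fin K :=
  if InChairs T₀ T₁ act t p then
    match fixed p with
    | some i => i
    | none =>
      learnedRanking T₀ act ω (epochStart T₁ t) p
        (sampleBelow ((ω t).2 p) (playerEstimate T₀ act ω (epochStart T₁ t) p))
  else exploreArm ω t p

/-- The arm on which each player is fixed at the beginning of a round.  A player becomes fixed on
the first arm that she chooses without a collision in the musical chairs phase, and remains so until
the epoch ends (or until she leaves). -/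
def fixedArm (T₀ T₁ : ℕ) (act : ℕ → Finset (Fin M)) (ω : ℕ → RoundSeed K M) :
    ℕ → Fin M → Option (Fin K)
  | 0 => fun _ => none
  | t + 1 => fun p =>
    if (t + 1) % T₁ = 0 ∨ ¬ InChairs T₀ T₁ act t p then none
    else
      match fixedArm T₀ T₁ act ω t p with
      | some i => some i
      | none =>
        if Collides (act t) (chooseArm T₀ T₁ act ω t (fixedArm T₀ T₁ act ω t)) p then none
        else some (chooseArm T₀ T₁ act ω t (fixedArm T₀ T₁ act ω t) p)

/-- The arm that `p` chooses in round `t` of a run of the algorithm. -/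
def arm (T₀ T₁ : ℕ) (act : ℕ → Finset (Fin M)) (ω : ℕ → RoundSeed K M) (t : ℕ) (p : Fin M) :
    Fin K :=
  chooseArm T₀ T₁ act ω t (fixedArm T₀ T₁ act ω t) p

/-- The regret of the algorithm in the rounds `0, …, T - 1`, with respect to the best allocation of
the players that are present to the arms; `μ` are the mean rewards of the arms. -/
def regret (T₀ T₁ : ℕ) (act : ℕ → Finset (Fin M)) (μ : Fin K → ℝ) (T : ℕ)
    (ω : ℕ → RoundSeed K M) : ℝ :=
  ∑ t ∈ Finset.range T,
    ((∑ i : Fin K, if (i : ℕ) < (act t).card then μ (ranking μ i) else 0) -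
      ∑ p ∈ act t,
        if Collides (act t) (arm T₀ T₁ act ω t) p then 0 else μ (arm T₀ T₁ act ω t p))

/-- The event that the learning succeeds: in every epoch whose learning rounds are completed within
the horizon `T` and are not disturbed by a player who enters or leaves, every player ends up with an
`ε`-correct ranking and with the true number of players. -/
def learningSucceeds (ε : ℝ) (T₀ T₁ : ℕ) (act : ℕ → Finset (Fin M)) (μ : Fin K → ℝ) (T : ℕ) :
    Set (ℕ → RoundSeed K M) :=
  {ω | ∀ m : ℕ, m * T₁ + T₀ ≤ T →
    (∀ t ∈ Finset.Ico (m * T₁) (m * T₁ + T₀), act t = act (m * T₁)) →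
    ∀ p ∈ act (m * T₁),
      IsCorrectRanking ε μ (learnedRanking T₀ act ω (m * T₁) p) ∧
        playerEstimate T₀ act ω (m * T₁) p = (act (m * T₁)).card}

end Algorithm

/-! # The scenario and the parameters -/

/-- The time `⌈T ^ l⌉` between two changes of the set of players. -/
def period (T : ℕ) (l : ℝ) : ℕ := ⌈(T : ℝ) ^ l⌉₊

/-- The set of players just before round `t`; `init` is the set before round `0`. -/
def playersBefore {M : ℕ} (init : Finset (Fin M)) (act : ℕ → Finset (Fin M)) : ℕ → Finset (Fin M)
  | 0 => init
  | t + 1 => act t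

/-- Up to the horizon `T`, exactly one player leaves at each of the rounds `2 * r * L`, exactly one
player enters at each of the rounds `(2 * r + 1) * L` (`r = 0, 1, 2, …`), and the set of players
does not change otherwise. -/
structure IsAlternating {M : ℕ} (T L : ℕ) (init : Finset (Fin M)) (act : ℕ → Finset (Fin M)) :
    Prop where
  leave : ∀ r : ℕ, 2 * r * L < T →
    ∃ p ∈ playersBefore init act (2 * r * L),
      act (2 * r * L) = (playersBefore init act (2 * r * L)).erase p
  enter : ∀ r : ℕ, (2 * r + 1) * L < T →
    ∃ p ∉ playersBefore init act ((2 * r + 1) * L),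
      act ((2 * r + 1) * L) = insert p (playersBefore init act ((2 * r + 1) * L))
  stay : ∀ t < T, ¬ L ∣ t → act t = playersBefore init act t

/-- The number of learning rounds per epoch. -/
def learningRounds (K : ℕ) (ε δ : ℝ) (T : ℕ) : ℕ :=
  ⌈max
    (max ((K : ℝ) / 2 * Real.log (2 * (K : ℝ) ^ 2 / (δ / (2 * T))))
      (16 * (K : ℝ) / ε ^ 2 * Real.log (4 * (K : ℝ) ^ 2 / (δ / (2 * T)))))
    ((K : ℝ) ^ 2 * Real.log (4 * T / δ) / 0.02)⌉₊

/-- The length of an epoch, `⌈√(T * (T₀ + 2 * Tf) / x)⌉` (and at least `T₀ + 1`), where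
`T₀` is the number of learning rounds, `Tf = exp 2 * K`, and `x = ⌈T / L⌉` is the number of rounds
`0, L, 2 * L, … < T` at which a player leaves or enters, with `L = ⌈T ^ l⌉`. -/
def epochLength (K : ℕ) (ε δ : ℝ) (T : ℕ) (l : ℝ) : ℕ :=
  max
    ⌈√((T : ℝ) * (learningRounds K ε δ T + 2 * (Real.exp 2 * K)) / ⌈(T : ℝ) / period T l⌉₊)⌉₊
    (learningRounds K ε δ T + 1)

/-! # The MEGA bound -/

/-- The contribution of the leaving players to the regret upper bound of the MEGA algorithm with
parameter `β`: a player leaving at round `t` contributes `t ^ β`; the leaving rounds are the numbers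
`2 * r * L < T`. -/
def megaDepartures (β : ℝ) (T L : ℕ) : ℝ :=
  ∑ t ∈ (Finset.range T).filter (fun t => 2 * L ∣ t), (t : ℝ) ^ β

/-- The regret upper bound of the MEGA algorithm: the contribution of the leaving players, plus an
amount `other` for all other sources of regret, capped by the trivial bound `T`. -/
def megaBound (β : ℝ) (T L : ℕ) (other : ℝ) : ℝ := min (T : ℝ) (other + megaDepartures β T L)

end

end MusicalChairs

namespace MusicalChairs

noncomputable section


/-! # Product measures -/

section Product

variable {X : Type*} [MeasurableSpace X] (Q : Measure X) [IsProbabilityMeasure Q]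

/-! MEGA. About half of the roughly `T/(2L)` departures happen at rounds of order `T`, and each of
these contributes at least a constant times `T^β`. With `L` of order `T^l` the sum is of order
`T^(1-l+β)`. As `l > β`, this is below `T`, so the cap is harmless.

DMC. The regret is charged epoch by epoch. At most `x = ⌈T/L⌉` epochs contain a round at which the
set of players may change, and each round of these is charged an extra `K`. Otherwise an epoch costs
`K` per learning round plus the price of musical chairs.

That price is bounded given successful learning. All players then agree on the set of the `N` best
arms and on `N`, although their rankings may order these arms differently. Fixed players sit on
distinct best arms, so an unfixed player always leaves some best arm free by pigeonhole. She draws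
it, while no other player draws the position of that arm in her own ranking, with probability at
least `exp (-1) / K`. Hence the chance of being unfixed decays geometrically
(`IsQuiet.gameLaw_real_unfixed_le`), and once everybody is fixed the round has no regret. Musical
chairs therefore cost at most `3 K ^ 3` per epoch, and `setIntegral_regret_le` gives the total
`(T/T₁ + 1)(K T₀ + 3K³) + K T₁ x`. The choice of `T₁` balances the two terms at order `√(T x)`, that
is `T^(1-l/2)` (`epochLength_tradeoff`).

Learning succeeds by Chernoff bounds for independent rounds. The collision-free fraction
concentrates around `(1 - 1/K)^(N-1)`, which determines `N` (`round_log_div_log_eq`), and every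
empirical mean is within `ε/2` of the true one. A union bound over arms, players and epochs makes
the failure probability at most `δ/2`, so conditioning on success costs no more than a factor 2,
even for `δ` near 1. -/

theorem infinitePi_real_sum_nonneg_le {f : X → ℝ} (hf : Measurable f)
    (hint : Integrable (fun x => Real.exp (f x)) Q) {ρ : ℝ}
    (hρ : ∫ x, Real.exp (f x) ∂Q ≤ ρ) (s : Finset ℕ) :
    (Measure.infinitePi fun _ : ℕ => Q).real {ω | 0 ≤ ∑ t ∈ s, f (ω t)} ≤ ρ ^ s.card := by
  set P := Measure.infinitePi fun _ : ℕ => Q with hP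
  have hind : iIndepFun (fun (t : ℕ) (ω : ℕ → X) => f (ω t)) P :=
    iIndepFun_infinitePi (P := fun _ : ℕ => Q) (X := fun _ => f) fun _ => hf
  have hmeas : ∀ t : ℕ, Measurable fun ω : ℕ → X => f (ω t) := fun t =>
    hf.comp (measurable_pi_apply t)
  have hmp : ∀ t : ℕ, MeasurePreserving (Function.eval t) P Q := fun t =>
    measurePreserving_eval_infinitePi (fun _ : ℕ => Q) t
  have hmgf : ∀ t : ℕ, mgf (fun ω : ℕ → X => f (ω t)) P 1 ≤ ρ := by
    intro t
    have h := integral_map (μ := P) (φ := Function.eval t) (hmp t).measurable.aemeasurable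
      (f := fun x => Real.exp (f x)) (by rw [(hmp t).map_eq]; exact hint.1)
    rw [(hmp t).map_eq] at h
    simp only [mgf, one_mul]
    exact h ▸ hρ
  have hexp : Integrable (fun ω => Real.exp (1 * (∑ t ∈ s, fun ω : ℕ → X => f (ω t)) ω)) P :=
    hind.integrable_exp_mul_sum hmeas fun t _ => by
      simpa only [one_mul, Function.comp_def] using (hmp t).integrable_comp_of_integrable hint
  -- Chernoff with parameter 1 and threshold 0: scaling and threshold are left to the choice of `f`.
  have h := measure_ge_le_exp_mul_mgf (μ := P) (t := 1) 0 zero_le_one hexp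
  rw [hind.mgf_sum hmeas] at h
  calc P.real {ω | 0 ≤ ∑ t ∈ s, f (ω t)}
      ≤ ∏ t ∈ s, mgf (fun ω : ℕ → X => f (ω t)) P 1 := by simpa using h
    _ ≤ ∏ _t ∈ s, ρ := Finset.prod_le_prod (fun _ _ => mgf_nonneg) fun t _ => hmgf t
    _ = ρ ^ s.card := by simp

/-- Independence of the present round from the past. An event that depends only on the coordinates
below `t` is pulled back to finitely many coordinates by filling the others with an arbitrary point,
so independence of finite blocks applies. -/
theorem infinitePi_real_inter_eval {A : Set (ℕ → X)} (hA : MeasurableSet A) {t : ℕ}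
    (hdep : DependsOn (· ∈ A) (Set.Iio t)) {S : Set X} (hS : MeasurableSet S) :
    (Measure.infinitePi fun _ : ℕ => Q).real (A ∩ {ω | ω t ∈ S}) =
      (Measure.infinitePi fun _ : ℕ => Q).real A * Q.real S := by
  set P := Measure.infinitePi fun _ : ℕ => Q with hP
  obtain ⟨x₀⟩ := nonempty_of_isProbabilityMeasure Q
  let extend : (∀ _ : Finset.range t, X) → ℕ → X := fun y s =>
    if h : s ∈ Finset.range t then y ⟨s, h⟩ else x₀
  have hext : Measurable extend := by
    refine measurable_pi_lambda _ fun s => ?_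
    by_cases h : s ∈ Finset.range t
    · simpa only [extend, h, dif_pos] using measurable_pi_apply _
    · simp only [extend, h, dif_neg, not_false_eq_true, measurable_const]
  have hind : iIndepFun (fun (i : ℕ) (ω : ℕ → X) => ω i) P :=
    iIndepFun_infinitePi (P := fun _ : ℕ => Q) (X := fun _ x => x) fun _ => measurable_id
  have hI := hind.indepFun_finset (Finset.range t) {t} (by simp) fun i => measurable_pi_apply i
  have h := hI.measure_inter_preimage_eq_mul (extend ⁻¹' A)
    {y | y ⟨t, Finset.mem_singleton_self t⟩ ∈ S} (hext hA) (measurable_pi_apply _ hS)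
  have h1 : (fun (ω : ℕ → X) (i : Finset.range t) => ω i) ⁻¹' (extend ⁻¹' A) = A := by
    ext ω
    refine iff_of_eq (hdep fun s hs => ?_)
    simp only [extend, Finset.mem_range.2 (Set.mem_Iio.1 hs), dif_pos]
  have h2 : (fun (ω : ℕ → X) (i : ({t} : Finset ℕ)) => ω i) ⁻¹'
      {y | y ⟨t, Finset.mem_singleton_self t⟩ ∈ S} = Function.eval t ⁻¹' S := rfl
  rw [h1, h2, (measurePreserving_eval_infinitePi (fun _ : ℕ => Q) t).measure_preimage
    hS.nullMeasurableSet] at h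
  have h3 : A ∩ {ω | ω t ∈ S} = A ∩ Function.eval t ⁻¹' S := rfl
  rw [h3, measureReal_def, h, ENNReal.toReal_mul]
  rfl

/-- A one-step conditional bound without conditional expectations: the target `S (D ω)` may depend
on the past, but only through the finitely many values of `D`. On each piece where `D` is constant
the target is fixed and independence applies. -/
theorem infinitePi_real_miss_le {ι : Type*} [Finite ι] {A : Set (ℕ → X)} (hA : MeasurableSet A)
    {t : ℕ} (hdepA : DependsOn (· ∈ A) (Set.Iio t)) {D : (ℕ → X) → ι}
    (hD : ∀ d, MeasurableSet {ω | D ω = d}) (hdepD : DependsOn D (Set.Iio t))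
    {S : ι → Set X} (hS : ∀ d, MeasurableSet (S d)) {c : ℝ}
    (hc : ∀ ω ∈ A, c ≤ Q.real (S (D ω))) :
    (Measure.infinitePi fun _ : ℕ => Q).real {ω | ω ∈ A ∧ ω t ∉ S (D ω)} ≤
      (1 - c) * (Measure.infinitePi fun _ : ℕ => Q).real A := by
  set P := Measure.infinitePi fun _ : ℕ => Q with hP
  have := Fintype.ofFinite ι
  have hAd : ∀ d, MeasurableSet (A ∩ {ω | D ω = d}) := fun d => hA.inter (hD d)
  have hdisj : Pairwise (Function.onFun Disjoint fun d => A ∩ {ω | D ω = d}) := by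
    intro d d' hne
    refine Set.disjoint_left.2 fun ω h h' => hne (h.2.symm.trans h'.2)
  have hsum : P.real A = ∑ d, P.real (A ∩ {ω | D ω = d}) := by
    rw [← measureReal_iUnion_fintype hdisj hAd]
    congr 1
    ext ω
    simp
  have hcover : {ω | ω ∈ A ∧ ω t ∉ S (D ω)} =
      ⋃ d, (A ∩ {ω | D ω = d}) ∩ {ω | ω t ∈ (S d)ᶜ} := by
    ext ω
    simp only [Set.mem_ofPred_eq, Set.mem_iUnion, Set.mem_inter_iff, Set.mem_compl_iff]
    constructor
    · rintro ⟨h1, h2⟩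
      exact ⟨D ω, ⟨h1, rfl⟩, h2⟩
    · rintro ⟨d, ⟨h1, rfl⟩, h2⟩
      exact ⟨h1, h2⟩
  rw [hcover, hsum, Finset.mul_sum]
  refine (measureReal_iUnion_fintype_le _).trans (Finset.sum_le_sum fun d _ => ?_)
  rw [infinitePi_real_inter_eval Q (hAd d) _ (hS d).compl]
  -- The lower bound `c` is known only for values of `D` that occur on `A`; the other pieces are
  -- empty.
  · rcases (A ∩ {ω | D ω = d}).eq_empty_or_nonempty with h | ⟨ω, hω, rfl⟩
    · simp [h]
    · rw [mul_comm, probReal_compl_eq_one_sub (hS _)]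
      exact mul_le_mul_of_nonneg_right (by linarith [hc ω hω]) measureReal_nonneg
  · intro ω ω' h
    have h1 := hdepA h
    have h2 := hdepD h
    simp only [Set.mem_inter_iff, Set.mem_ofPred_eq] at h1 ⊢
    rw [h1, h2]

end Product

/-! # The draws of one round -/

section Draws

variable {K M : ℕ}

/-- The law of the draws of one player in one round. -/
def drawLaw (K : ℕ) : Measure (Draw K) :=
  Measure.pi fun m : Fin K => (PMF.uniformOfFintype (Fin ((m : ℕ) + 1))).toMeasure

instance : IsProbabilityMeasure (drawLaw K) := by
  unfold drawLaw
  infer_instance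

/-- The law of the draws of all players in one round. -/
def drawsLaw (K M : ℕ) : Measure (Fin M → Draw K) := Measure.pi fun _ : Fin M => drawLaw K

instance : IsProbabilityMeasure (drawsLaw K M) := by
  unfold drawsLaw
  infer_instance

theorem roundLaw_eq_prod (ν : Fin K → Measure ℝ) :
    roundLaw M ν = (Measure.pi ν).prod (drawsLaw K M) := rfl

/-- The worst exponent is `k = n - 1 = m`, and there `1 - 1/(m+1) = (1 + 1/m)⁻¹ ≥ exp (-1/m)`. -/
theorem exp_neg_one_le_one_sub_inv_pow {n k : ℕ} (hn : 0 < n) (hk : k + 1 ≤ n) :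
    Real.exp (-1) ≤ (1 - 1 / (n : ℝ)) ^ k := by
  have hn1 : (1 : ℝ) ≤ n := by exact_mod_cast hn
  have h0 : (0 : ℝ) ≤ 1 - 1 / (n : ℝ) := by
    rw [sub_nonneg]
    exact div_le_one_of_le₀ hn1 (by positivity)
  have h1 : (1 - 1 / (n : ℝ)) ≤ 1 := by
    have : (0 : ℝ) ≤ 1 / n := by positivity
    linarith
  refine le_trans ?_ (pow_le_pow_of_le_one h0 h1 (show k ≤ n - 1 by omega))
  obtain ⟨m, rfl⟩ : ∃ m, n = m + 1 := ⟨n - 1, by omega⟩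
  rcases Nat.eq_zero_or_pos m with rfl | hm
  · simp
  have hm' : (0 : ℝ) < m := by exact_mod_cast hm
  have h2 : Real.exp (-(1 / (m : ℝ))) ≤ 1 - 1 / ((m + 1 : ℕ) : ℝ) := by
    rw [Real.exp_neg, show 1 - 1 / ((m + 1 : ℕ) : ℝ) = (1 / (m : ℝ) + 1)⁻¹ by
      push_cast; field_simp; ring]
    exact inv_anti₀ (by positivity) (Real.add_one_le_exp _)
  calc Real.exp (-1) = Real.exp (-(1 / (m : ℝ))) ^ m := by
        rw [← Real.exp_nat_mul]
        congr 1
        field_simp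
    _ ≤ _ := pow_le_pow_left₀ (Real.exp_pos _).le h2 _

variable [NeZero K]

theorem drawLaw_real_sampleBelow_eq {n : ℕ} (hn : 0 < n) (hnK : n ≤ K) {j : ℕ} (hj : j < n) :
    (drawLaw K).real {d | (sampleBelow d n : ℕ) = j} = 1 / n := by
  have hmin : min n K - 1 = n - 1 := by omega
  let i : Fin K := ⟨min n K - 1, by omega⟩
  let a : Fin ((i : ℕ) + 1) := ⟨j, by simp only [i]; omega⟩
  have hset : {d : Draw K | (sampleBelow d n : ℕ) = j} = (fun d : Draw K => d i) ⁻¹' ({a} : Set (Fin ((i : ℕ) + 1))) := by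
    ext d
    simp only [sampleBelow, Fin.val_castLE, Set.mem_ofPred_eq, Set.mem_preimage,
      Set.mem_singleton_iff, Fin.ext_iff, a, i]
  have hmp := measurePreserving_eval
    (fun m : Fin K => (PMF.uniformOfFintype (Fin ((m : ℕ) + 1))).toMeasure) i
  rw [hset, measureReal_def, drawLaw, hmp.measure_preimage (measurableSet_singleton a).nullMeasurableSet,
    PMF.toMeasure_apply_singleton _ _ (measurableSet_singleton a), PMF.uniformOfFintype_apply]
  simp only [Fintype.card_fin, ENNReal.toReal_inv, ENNReal.toReal_natCast, one_div, i]
  congr 2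
  omega

/-- The probability that `p`, drawing below `n`, draws her target while no other player of `S` draws
her own. -/
theorem drawsLaw_real_soleDraw {n : ℕ} (hn : 0 < n) (hnK : n ≤ K) {S : Finset (Fin M)} {p : Fin M}
    (hp : p ∈ S) {pos : Fin M → ℕ} (hpos : ∀ q ∈ S, pos q < n) :
    (drawsLaw K M).real {d | (sampleBelow (d p) n : ℕ) = pos p ∧
      ∀ q ∈ S, q ≠ p → (sampleBelow (d q) n : ℕ) ≠ pos q} =
      1 / n * (1 - 1 / (n : ℝ)) ^ (S.card - 1) := by
  classical
  have hset : {d : Fin M → Draw K | (sampleBelow (d p) n : ℕ) = pos p ∧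
      ∀ q ∈ S, q ≠ p → (sampleBelow (d q) n : ℕ) ≠ pos q} =
      Set.univ.pi fun q => if q = p then {d : Draw K | (sampleBelow d n : ℕ) = pos q} else
        if q ∈ S then {d : Draw K | (sampleBelow d n : ℕ) = pos q}ᶜ else Set.univ := by
    ext d
    simp only [Set.mem_ofPred_eq, Set.mem_pi, Set.mem_univ, true_implies]
    constructor
    · rintro ⟨h1, h2⟩ q
      split_ifs with hq hqS
      · subst hq; exact h1
      · exact h2 q hqS hq
      · trivial
    · intro h
      refine ⟨by simpa using h p, fun q hqS hq => ?_⟩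
      simpa [hq, hqS] using h q
  rw [hset, measureReal_def, drawsLaw, Measure.pi_pi, ENNReal.toReal_prod,
    ← Finset.prod_subset (Finset.subset_univ S), ← Finset.mul_prod_erase S _ hp]
  · congr 1
    · rw [if_pos rfl]
      exact drawLaw_real_sampleBelow_eq hn hnK (hpos p hp)
    · rw [← Finset.card_erase_of_mem hp]
      refine Finset.prod_eq_pow_card fun q hq => ?_
      rw [if_neg (Finset.ne_of_mem_erase hq), if_pos (Finset.mem_of_mem_erase hq),
        ← measureReal_def, probReal_compl_eq_one_sub .of_discrete,
        drawLaw_real_sampleBelow_eq hn hnK (hpos q (Finset.mem_of_mem_erase hq))]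
  · intro q _ hq
    rw [if_neg (by rintro rfl; exact hq hp), if_neg hq]
    simp

/-- The targets `pos q` vary with the player because one and the same arm has different positions in
different rankings. As no more than `n` players draw, the factor for the others' misses stays above
`exp (-1)`. -/
theorem le_drawsLaw_real_soleDraw {n : ℕ} (hn : 0 < n) (hnK : n ≤ K) {S : Finset (Fin M)}
    {p : Fin M} (hp : p ∈ S) (hS : S.card ≤ n) {pos : Fin M → ℕ} (hpos : ∀ q ∈ S, pos q < n) :
    Real.exp (-1) / K ≤ (drawsLaw K M).real {d | (sampleBelow (d p) n : ℕ) = pos p ∧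
      ∀ q ∈ S, q ≠ p → (sampleBelow (d q) n : ℕ) ≠ pos q} := by
  rw [drawsLaw_real_soleDraw hn hnK hp hpos]
  have hc : 0 < S.card := Finset.card_pos.2 ⟨p, hp⟩
  have h1 := exp_neg_one_le_one_sub_inv_pow (k := S.card - 1) hn (by omega)
  have hn' : (0 : ℝ) < n := by exact_mod_cast hn
  have hnK' : (n : ℝ) ≤ K := by exact_mod_cast hnK
  calc Real.exp (-1) / K ≤ Real.exp (-1) / n := by gcongr
    _ = 1 / n * Real.exp (-1) := by ring
    _ ≤ _ := by gcongr

end Draws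


instance {K M : ℕ} (ν : Fin K → Measure ℝ) [∀ i, IsProbabilityMeasure (ν i)] :
    IsProbabilityMeasure (gameLaw M ν) := by
  unfold gameLaw
  infer_instance

/-! # Measurability of the algorithm, and dependence on the past -/

section Measurability

variable {K M : ℕ}

instance permMeasurableSpace : MeasurableSpace (Equiv.Perm (Fin K)) := ⊤

instance : DiscreteMeasurableSpace (Equiv.Perm (Fin K)) := ⟨fun _ => trivial⟩

instance optionMeasurableSpace : MeasurableSpace (Option (Fin K)) := ⊤

instance : DiscreteMeasurableSpace (Option (Fin K)) := ⟨fun _ => trivial⟩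

/-- There are finitely many permutations, and the fibre over each is cut out by finitely many
comparisons: sorted values, with ties broken by the index. -/
theorem measurable_ranking : Measurable (ranking : (Fin K → ℝ) → Equiv.Perm (Fin K)) := by
  refine measurable_to_countable' fun σ => ?_
  have h : ranking ⁻¹' {σ} = {f : Fin K → ℝ | ∀ i j, i ≤ j → f (σ j) ≤ f (σ i)} ∩
      {f | ∀ i j, i < j → f (σ i) = f (σ j) → σ i < σ j} := by
    ext f
    simp only [Set.mem_preimage, Set.mem_singleton_iff, ranking, Set.mem_inter_iff,
      Set.mem_ofPred_eq]
    rw [eq_comm, Tuple.eq_sort_iff]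
    simp only [Monotone, Function.comp_apply, neg_le_neg_iff, neg_inj]
  rw [h]
  have hm : ∀ i, Measurable fun f : Fin K → ℝ => f (σ i) := fun i => measurable_pi_apply _
  refine MeasurableSet.inter ?_ ?_
  · simp only [Set.ofPred_forall]
    exact .iInter fun i => .iInter fun j => .iInter fun _ => measurableSet_le (hm j) (hm i)
  · simp only [Set.ofPred_forall]
    refine .iInter fun i => .iInter fun j => .iInter fun _ => ?_
    exact Measurable.setOf (Measurable.imp
      (measurableSet_setOfPred.1 (measurableSet_eq_fun (hm i) (hm j))) measurable_const)

theorem measurable_draws (t : ℕ) : Measurable fun ω : ℕ → RoundSeed K M => (ω t).2 :=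
  measurable_snd.comp (measurable_pi_apply t)

variable [NeZero K] (T₀ T₁ : ℕ) (act : ℕ → Finset (Fin M))

theorem measurable_exploreArm (t : ℕ) :
    Measurable fun ω : ℕ → RoundSeed K M => exploreArm ω t :=
  (Measurable.of_discrete (f := fun (d : Fin M → Draw K) (p : Fin M) => sampleBelow (d p) K)).comp
    (measurable_draws t)

theorem measurable_collisionCount (s : ℕ) (p : Fin M) :
    Measurable fun ω : ℕ → RoundSeed K M => collisionCount T₀ act ω s p := by
  unfold collisionCount
  refine Finset.measurable_sum _ fun t _ => ?_
  exact (Measurable.of_discrete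
    (f := fun a : Fin M → Fin K => if Collides (act t) a p then 1 else 0)).comp
    (measurable_exploreArm t)

theorem measurable_observationCount (s : ℕ) (p : Fin M) (i : Fin K) :
    Measurable fun ω : ℕ → RoundSeed K M => observationCount T₀ act ω s p i := by
  unfold observationCount
  refine Finset.measurable_sum _ fun t _ => ?_
  exact (Measurable.of_discrete
    (f := fun a : Fin M → Fin K => if a p = i ∧ ¬ Collides (act t) a p then 1 else 0)).comp
    (measurable_exploreArm t)

theorem measurable_rewardSum (s : ℕ) (p : Fin M) (i : Fin K) :
    Measurable fun ω : ℕ → RoundSeed K M => rewardSum T₀ act ω s p i := by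
  unfold rewardSum
  refine Finset.measurable_sum _ fun t _ => ?_
  refine Measurable.ite ?_ ?_ measurable_const
  · exact measurable_exploreArm t (.of_discrete
      (s := {a : Fin M → Fin K | a p = i ∧ ¬ Collides (act t) a p}))
  · exact (measurable_pi_apply i).comp (measurable_fst.comp (measurable_pi_apply t))

theorem measurable_learnedRanking (s : ℕ) (p : Fin M) :
    Measurable fun ω : ℕ → RoundSeed K M => learnedRanking T₀ act ω s p := by
  refine measurable_ranking.comp (measurable_pi_lambda _ fun i => ?_)
  exact (measurable_rewardSum T₀ act s p i).div
    ((Measurable.of_discrete (f := fun n : ℕ => (n : ℝ))).comp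
      (measurable_observationCount T₀ act s p i))

theorem measurable_playerEstimate (s : ℕ) (p : Fin M) :
    Measurable fun ω : ℕ → RoundSeed K M => playerEstimate T₀ act ω s p :=
  (Measurable.of_discrete (f := fun n : ℕ => if n = T₀ then K
  else (round (Real.log (((T₀ : ℝ) - n) / T₀) / Real.log (1 - 1 / (K : ℝ)) + 1)).toNat)).comp
    (measurable_collisionCount T₀ act s p)

theorem measurable_chooseArm (t : ℕ) {F : (ℕ → RoundSeed K M) → Fin M → Option (Fin K)}
    (hF : Measurable F) :
    Measurable fun ω : ℕ → RoundSeed K M => chooseArm T₀ T₁ act ω t (F ω) := by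
  refine measurable_pi_lambda _ fun p => ?_
  unfold chooseArm
  by_cases h : InChairs T₀ T₁ act t p
  · simp only [if_pos h]
    exact (Measurable.of_discrete
      (f := fun z : ((Option (Fin K) × Equiv.Perm (Fin K)) × ℕ) × Draw K => match z.1.1.1 with
        | some i => i
        | none => z.1.1.2 (sampleBelow z.2 z.1.2))).comp
      (((((measurable_pi_apply p).comp hF).prodMk (measurable_learnedRanking T₀ act _ p)).prodMk
        (measurable_playerEstimate T₀ act _ p)).prodMk
        ((measurable_pi_apply p).comp (measurable_draws t)))
  · simp only [if_neg h]
    exact (measurable_pi_apply p).comp (measurable_exploreArm t)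

theorem measurable_fixedArm (t : ℕ) :
    Measurable fun ω : ℕ → RoundSeed K M => fixedArm T₀ T₁ act ω t := by
  induction t with
  | zero => exact measurable_const
  | succ t ih =>
    exact (Measurable.of_discrete
      (f := fun (z : (Fin M → Option (Fin K)) × (Fin M → Fin K)) (p : Fin M) =>
        if (t + 1) % T₁ = 0 ∨ ¬ InChairs T₀ T₁ act t p then none
        else
          match z.1 p with
          | some i => some i
          | none => if Collides (act t) z.2 p then none else some (z.2 p))).comp
      (ih.prodMk (measurable_chooseArm T₀ T₁ act t ih))

theorem measurable_arm (t : ℕ) : Measurable fun ω : ℕ → RoundSeed K M => arm T₀ T₁ act ω t :=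
  measurable_chooseArm T₀ T₁ act t (measurable_fixedArm T₀ T₁ act t)

/-- The regret of one round. -/
def roundRegret (μ : Fin K → ℝ) (ω : ℕ → RoundSeed K M) (t : ℕ) : ℝ :=
  (∑ i : Fin K, if (i : ℕ) < (act t).card then μ (ranking μ i) else 0) -
    ∑ p ∈ act t, if Collides (act t) (arm T₀ T₁ act ω t) p then 0 else μ (arm T₀ T₁ act ω t p)

theorem regret_eq_sum_roundRegret (μ : Fin K → ℝ) (T : ℕ) (ω : ℕ → RoundSeed K M) :
    regret T₀ T₁ act μ T ω = ∑ t ∈ Finset.range T, roundRegret T₀ T₁ act μ ω t := rfl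

theorem measurable_roundRegret (μ : Fin K → ℝ) (t : ℕ) :
    Measurable fun ω : ℕ → RoundSeed K M => roundRegret T₀ T₁ act μ ω t :=
  (Measurable.of_discrete (f := fun a : Fin M → Fin K =>
    (∑ i : Fin K, if (i : ℕ) < (act t).card then μ (ranking μ i) else 0) -
      ∑ p ∈ act t, if Collides (act t) a p then 0 else μ (a p))).comp
    (measurable_arm T₀ T₁ act t)

/-- The learning of the players of `S` in the rounds `s, …, s + T₀ - 1` succeeds. -/
def learnsAt (ε : ℝ) (μ : Fin K → ℝ) (S : Finset (Fin M)) (s : ℕ) : Set (ℕ → RoundSeed K M) :=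
  {ω | ∀ p ∈ S, IsCorrectRanking ε μ (learnedRanking T₀ act ω s p) ∧
    playerEstimate T₀ act ω s p = S.card}

theorem measurableSet_learnsAt (ε : ℝ) (μ : Fin K → ℝ) (S : Finset (Fin M)) (s : ℕ) :
    MeasurableSet (learnsAt T₀ act ε μ S s) := by
  simp only [learnsAt, Set.ofPred_forall]
  refine .iInter fun p => .iInter fun _ => MeasurableSet.inter ?_ ?_
  · exact measurable_learnedRanking T₀ act s p
      (.of_discrete (s := {A | IsCorrectRanking ε μ A}))
  · exact measurable_playerEstimate T₀ act s p (.of_discrete (s := {S.card}))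

theorem learningSucceeds_eq_iInter (ε : ℝ) (μ : Fin K → ℝ) (T : ℕ) :
    learningSucceeds ε T₀ T₁ act μ T = ⋂ (m : ℕ) (_ : m * T₁ + T₀ ≤ T)
      (_ : ∀ t ∈ Finset.Ico (m * T₁) (m * T₁ + T₀), act t = act (m * T₁)),
      learnsAt T₀ act ε μ (act (m * T₁)) (m * T₁) := by
  ext ω
  simp only [learningSucceeds, learnsAt, Set.mem_iInter, Set.mem_ofPred_eq]

theorem measurableSet_learningSucceeds (ε : ℝ) (μ : Fin K → ℝ) (T : ℕ) :
    MeasurableSet (learningSucceeds (K := K) ε T₀ T₁ act μ T) := by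
  rw [learningSucceeds_eq_iInter]
  exact .iInter fun m => .iInter fun _ => .iInter fun _ => measurableSet_learnsAt ..

end Measurability

section Dependence

variable {K M : ℕ} [NeZero K] {T₀ T₁ : ℕ} {act : ℕ → Finset (Fin M)}
  {ω ω' : ℕ → RoundSeed K M}

theorem exploreArm_congr {t : ℕ} (h : ω t = ω' t) : exploreArm ω t = exploreArm ω' t := by
  funext p
  simp only [exploreArm, h]

theorem playerEstimate_congr {s : ℕ} (h : ∀ t < s + T₀, ω t = ω' t) :
    playerEstimate T₀ act ω s = playerEstimate T₀ act ω' s := by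
  have hc : collisionCount T₀ act ω s = collisionCount T₀ act ω' s := by
    funext p
    refine Finset.sum_congr rfl fun t ht => ?_
    rw [exploreArm_congr (h t (Finset.mem_Ico.1 ht).2)]
  funext p
  simp only [playerEstimate, hc]

theorem learnedRanking_congr {s : ℕ} (h : ∀ t < s + T₀, ω t = ω' t) :
    learnedRanking T₀ act ω s = learnedRanking T₀ act ω' s := by
  have ho : observationCount T₀ act ω s = observationCount T₀ act ω' s := by
    funext p i
    refine Finset.sum_congr rfl fun t ht => ?_
    rw [exploreArm_congr (h t (Finset.mem_Ico.1 ht).2)]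
  have hr : rewardSum T₀ act ω s = rewardSum T₀ act ω' s := by
    funext p i
    refine Finset.sum_congr rfl fun t ht => ?_
    rw [exploreArm_congr (h t (Finset.mem_Ico.1 ht).2), h t (Finset.mem_Ico.1 ht).2]
  funext p
  simp only [learnedRanking]
  congr 1
  funext i
  simp only [empiricalMean, ho, hr]

theorem chooseArm_congr {t : ℕ} (h : ∀ s ≤ t, ω s = ω' s) (F : Fin M → Option (Fin K)) :
    chooseArm T₀ T₁ act ω t F = chooseArm T₀ T₁ act ω' t F := by
  funext p
  unfold chooseArm
  by_cases hc : InChairs T₀ T₁ act t p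
  · have hs : ∀ s < epochStart T₁ t + T₀, ω s = ω' s := fun s hs => h s (by
      have := Nat.div_add_mod t T₁
      have := hc.1
      unfold epochStart at hs
      omega)
    simp only [if_pos hc, playerEstimate_congr hs, learnedRanking_congr hs, h t le_rfl]
  · simp only [if_neg hc, exploreArm_congr (h t le_rfl)]

theorem fixedArm_congr {t : ℕ} (h : ∀ s < t, ω s = ω' s) :
    fixedArm T₀ T₁ act ω t = fixedArm T₀ T₁ act ω' t := by
  induction t with
  | zero => rfl
  | succ t ih =>
    funext p
    simp only [fixedArm, ih fun s hs => h s (by omega),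
      chooseArm_congr (fun s hs => h s (Nat.lt_succ_of_le hs))]

theorem learnsAt_congr {ε : ℝ} {μ : Fin K → ℝ} {S : Finset (Fin M)} {s : ℕ}
    (h : ∀ t < s + T₀, ω t = ω' t) :
    ω ∈ learnsAt T₀ act ε μ S s ↔ ω' ∈ learnsAt T₀ act ε μ S s := by
  simp only [learnsAt, Set.mem_ofPred_eq, playerEstimate_congr h, learnedRanking_congr h]

end Dependence


/-! # Concentration -/

section Hoeffding

variable {X : Type*} [MeasurableSpace X] (Q : Measure X) [IsProbabilityMeasure Q]

theorem integrable_exp_mul_of_mem_Icc {Y : X → ℝ} (hY : AEMeasurable Y Q)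
    (hb : ∀ᵐ x ∂Q, Y x ∈ Set.Icc (0 : ℝ) 1) (s a : ℝ) :
    Integrable (fun x => Real.exp (s * (Y x - a))) Q :=
  ProbabilityTheory.integrable_exp_mul_of_mem_Icc (a := 0 - a) (b := 1 - a) (hY.sub_const a) (by
    filter_upwards [hb] with x hx
    exact ⟨by linarith [hx.1], by linarith [hx.2]⟩)

theorem integral_exp_mul_sub_integral_le {Y : X → ℝ} (hY : AEMeasurable Y Q)
    (hb : ∀ᵐ x ∂Q, Y x ∈ Set.Icc (0 : ℝ) 1) (s : ℝ) :
    ∫ x, Real.exp (s * (Y x - ∫ y, Y y ∂Q)) ∂Q ≤ Real.exp (s ^ 2 / 8) := by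
  have h := (hasSubgaussianMGF_of_mem_Icc hY hb).mgf_le s
  refine h.trans_eq ?_
  congr 1
  simp
  ring

theorem integral_exp_mul_sub_sub_le {Y : X → ℝ} (hY : AEMeasurable Y Q)
    (hb : ∀ᵐ x ∂Q, Y x ∈ Set.Icc (0 : ℝ) 1) (s η : ℝ) :
    ∫ x, Real.exp (s * (Y x - ∫ y, Y y ∂Q) - η) ∂Q ≤ Real.exp (s ^ 2 / 8 - η) := by
  simp only [Real.exp_sub, integral_div]
  exact div_le_div_of_nonneg_right (integral_exp_mul_sub_integral_le Q hY hb s) (Real.exp_pos _).le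

/-- Hoeffding's inequality, with the sign `σ = ±1` selecting the tail. The optimal Chernoff
parameter is `4η`: the exponent per round is `(4η)²/8 - 4η² = -2η²`. -/
theorem infinitePi_real_le_sum_sub_le {Y : X → ℝ} (hY : Measurable Y)
    (hb : ∀ x, Y x ∈ Set.Icc (0 : ℝ) 1) (σ : ℝ) (hσ : σ ^ 2 = 1) (η : ℝ) (hη : 0 < η)
    (s : Finset ℕ) :
    (Measure.infinitePi fun _ : ℕ => Q).real
      {ω | s.card * η ≤ σ * (∑ t ∈ s, Y (ω t) - s.card * ∫ y, Y y ∂Q)} ≤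
      Real.exp (-(2 * η ^ 2)) ^ s.card := by
  have hset : {ω : ℕ → X | s.card * η ≤ σ * (∑ t ∈ s, Y (ω t) - s.card * ∫ y, Y y ∂Q)} =
      {ω | 0 ≤ ∑ t ∈ s, (4 * η * σ * (Y (ω t) - ∫ y, Y y ∂Q) - 4 * η ^ 2)} := by
    ext ω
    simp only [Set.mem_ofPred_eq, Finset.sum_sub_distrib, ← Finset.mul_sum, Finset.sum_const,
      nsmul_eq_mul]
    rw [← sub_nonneg, ← mul_nonneg_iff_of_pos_left (show 0 < 4 * η by positivity)]
    ring_nf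
  rw [hset]
  refine infinitePi_real_sum_nonneg_le Q (f := fun x => 4 * η * σ * (Y x - ∫ y, Y y ∂Q) - 4 * η ^ 2)
    (by fun_prop) ?_ ?_ s
  · simp only [Real.exp_sub]
    exact (integrable_exp_mul_of_mem_Icc Q hY.aemeasurable (.of_forall hb) _ _).div_const _
  · refine (integral_exp_mul_sub_sub_le Q hY.aemeasurable (.of_forall hb) _ _).trans_eq ?_
    congr 1
    rw [mul_pow, hσ]
    ring

end Hoeffding

/-! # Learning the number of players -/

section Estimate

variable {K M : ℕ}

section

variable (ν : Fin K → Measure ℝ) [∀ i, IsProbabilityMeasure (ν i)]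

theorem measurePreserving_snd_roundLaw :
    MeasurePreserving Prod.snd (roundLaw M ν) (drawsLaw K M) := by
  rw [roundLaw_eq_prod]
  exact measurePreserving_snd

theorem roundLaw_real_snd_mem (A : Set (Fin M → Draw K)) :
    (roundLaw M ν).real {x | x.2 ∈ A} = (drawsLaw K M).real A := by
  rw [measureReal_def, measureReal_def, ← (measurePreserving_snd_roundLaw ν).measure_preimage
    MeasurableSet.of_discrete.nullMeasurableSet]
  rfl

end

/-- Write `q = 1 - u` with `u = 1/K`. Since `q ^ n ≥ exp (-1) ≥ 1/3`, an absolute error below `u/6`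
is a relative error below `u/2`. This moves the logarithm by less than `|log q| / 2`, from above
because `log (1 + u/2) ≤ u/2 ≤ -log q / 2`, and from below because `(1 - u/2)² ≥ q`. Dividing by
`log q` leaves an error of at most 1/2, strict on the side where rounding needs it. -/
theorem round_log_div_log_eq {K n : ℕ} (hK : 2 ≤ K) (hn : n + 1 ≤ K) {x : ℝ}
    (hx : |x - (1 - 1 / (K : ℝ)) ^ n| < 1 / (6 * K)) :
    0 < x ∧ round (Real.log x / Real.log (1 - 1 / (K : ℝ)) + 1) = n + 1 := by
  have hK' : (2 : ℝ) ≤ K := by exact_mod_cast hK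
  have hK0 : (0 : ℝ) < K := by linarith
  set q : ℝ := 1 - 1 / (K : ℝ) with hq
  set u : ℝ := 1 / (K : ℝ) with hu
  have hu0 : 0 < u := by positivity
  have hu1 : u ≤ 1 / 2 := by
    rw [hu]
    exact one_div_le_one_div_of_le (by norm_num) hK'
  have hq0 : 0 < q := by linarith
  have hρ : 1 / 3 ≤ q ^ n := by
    refine le_trans ?_ (exp_neg_one_le_one_sub_inv_pow (by omega) hn)
    rw [Real.exp_neg, ← one_div]
    exact one_div_le_one_div_of_le (Real.exp_pos 1) (by linarith [Real.exp_one_lt_d9])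
  have hρ0 : 0 < q ^ n := by positivity
  have h6 : 1 / (6 * (K : ℝ)) = u / 6 := by rw [hu]; field_simp
  rw [h6, abs_lt] at hx
  have hlow : q ^ n * (1 - u / 2) < x := by nlinarith
  have hup : x < q ^ n * (1 + u / 2) := by nlinarith
  have hx0 : 0 < x := lt_trans (mul_pos hρ0 (by linarith)) hlow
  have hlq : Real.log q ≤ -u := by
    have := Real.log_le_sub_one_of_pos hq0
    linarith
  have h1 : Real.log x < n * Real.log q + u / 2 := by
    calc Real.log x < Real.log (q ^ n * (1 + u / 2)) := Real.log_lt_log hx0 hup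
      _ = n * Real.log q + Real.log (1 + u / 2) := by
        rw [Real.log_mul hρ0.ne' (by positivity), Real.log_pow]
      _ ≤ _ := by
        have := Real.log_le_sub_one_of_pos (show 0 < 1 + u / 2 by positivity)
        linarith
  have h2 : n * Real.log q + Real.log q / 2 < Real.log x := by
    have h3 : Real.log q ≤ Real.log ((1 - u / 2) ^ 2) := Real.log_le_log hq0 (by nlinarith)
    rw [Real.log_pow] at h3
    have h4 : Real.log (q ^ n * (1 - u / 2)) < Real.log x :=
      Real.log_lt_log (mul_pos hρ0 (by linarith)) hlow
    rw [Real.log_mul hρ0.ne' (by linarith), Real.log_pow] at h4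
    push_cast at h3
    linarith
  refine ⟨hx0, ?_⟩
  have hlq0 : Real.log q < 0 := by linarith
  rw [round_eq, Int.floor_eq_iff]
  push_cast
  constructor
  · have : (n : ℝ) - 1 / 2 ≤ Real.log x / Real.log q := by
      rw [le_div_iff_of_neg hlq0]
      linarith
    linarith
  · have : Real.log x / Real.log q < n + 1 / 2 := by
      rw [div_lt_iff_of_neg hlq0]
      linarith
    linarith

variable [NeZero K]

/-- The arms that exploring players choose. -/
def exploreChoice (d : Fin M → Draw K) (p : Fin M) : Fin K := sampleBelow (d p) K

/-- The indicator of the event that `p` explores arm `i` without a collision. -/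
def observes (S : Finset (Fin M)) (p : Fin M) (i : Fin K) : Set (Fin M → Draw K) :=
  {d | exploreChoice d p = i ∧ ¬ Collides S (exploreChoice d) p}

theorem observes_eq (S : Finset (Fin M)) (p : Fin M) (i : Fin K) :
    observes S p i = {d | (sampleBelow (d p) K : ℕ) = (fun _ => (i : ℕ)) p ∧
      ∀ q ∈ S, q ≠ p → (sampleBelow (d q) K : ℕ) ≠ (fun _ => (i : ℕ)) q} := by
  ext d
  simp only [observes, exploreChoice, Set.mem_ofPred_eq, Fin.ext_iff, not_exists, not_and]
  refine and_congr_right fun h => ?_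
  rw [h]

theorem drawsLaw_real_observes {S : Finset (Fin M)} {p : Fin M} (hp : p ∈ S) (i : Fin K) :
    (drawsLaw K M).real (observes S p i) = 1 / K * (1 - 1 / (K : ℝ)) ^ (S.card - 1) := by
  rw [observes_eq]
  exact drawsLaw_real_soleDraw (NeZero.pos K) le_rfl hp fun _ _ => i.isLt

theorem drawsLaw_real_not_collides {S : Finset (Fin M)} {p : Fin M} (hp : p ∈ S) :
    (drawsLaw K M).real {d | ¬ Collides S (exploreChoice d) p} =
      (1 - 1 / (K : ℝ)) ^ (S.card - 1) := by
  have hU : {d : Fin M → Draw K | ¬ Collides S (exploreChoice d) p} = ⋃ i, observes S p i := by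
    ext d
    simp [observes]
  rw [hU, measureReal_iUnion_fintype _ fun _ => .of_discrete]
  · simp only [drawsLaw_real_observes hp, Finset.sum_const, Finset.card_univ, Fintype.card_fin,
      nsmul_eq_mul]
    have : (K : ℝ) ≠ 0 := Nat.cast_ne_zero.2 (NeZero.ne K)
    field_simp
  · intro i j hij
    exact Set.disjoint_left.2 fun d h h' => hij (h.1.symm.trans h'.1)

variable (ν : Fin K → Measure ℝ) [∀ i, IsProbabilityMeasure (ν i)]

/-- The tolerance `1/(6K)` of `round_log_div_log_eq` is fed into Hoeffding's inequality for both
tails of the collision-free fraction. -/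
theorem gameLaw_real_playerEstimate_ne_le {T₀ : ℕ} (hT₀ : 0 < T₀) {act : ℕ → Finset (Fin M)}
    {S : Finset (Fin M)} {s : ℕ} (hact : ∀ t ∈ Finset.Ico s (s + T₀), act t = S) {p : Fin M}
    (hp : p ∈ S) (hS : S.card < K) :
    (gameLaw M ν).real {ω | playerEstimate T₀ act ω s p ≠ S.card} ≤
      2 * Real.exp (-(T₀ / (18 * (K : ℝ) ^ 2))) := by
  classical
  have hN : 0 < S.card := Finset.card_pos.2 ⟨p, hp⟩
  have hK0 : (0 : ℝ) < K := by exact_mod_cast NeZero.pos K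
  have hT0 : (0 : ℝ) < T₀ := by exact_mod_cast hT₀
  set A : Set (RoundSeed K M) := {x | x.2 ∈ {d | ¬ Collides S (exploreChoice d) p}} with hAdef
  have hA : MeasurableSet A := measurable_snd (.of_discrete (s := {d | ¬ Collides S (exploreChoice d) p}))
  set Y : RoundSeed K M → ℝ := A.indicator 1 with hYdef
  have hY : Measurable Y := measurable_one.indicator hA
  have hYb : ∀ x, Y x ∈ Set.Icc (0 : ℝ) 1 := fun x => by
    by_cases h : x ∈ A <;> simp [Y, h]
  have hEY : ∫ x, Y x ∂(roundLaw M ν) = (1 - 1 / (K : ℝ)) ^ (S.card - 1) := by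
    rw [hYdef, integral_indicator_one hA, roundLaw_real_snd_mem, drawsLaw_real_not_collides hp]
  have hcard : (Finset.Ico s (s + T₀)).card = T₀ := by simp
  have hpow : Real.exp (-(2 * (1 / (6 * (K : ℝ))) ^ 2)) ^ (Finset.Ico s (s + T₀)).card =
      Real.exp (-(T₀ / (18 * (K : ℝ) ^ 2))) := by
    rw [hcard, ← Real.exp_nat_mul]
    congr 1
    field_simp
    norm_num
  have hdev := fun (σ : ℝ) (hσ : σ ^ 2 = 1) =>
    (infinitePi_real_le_sum_sub_le (roundLaw M ν) hY hYb σ hσ (1 / (6 * K)) (by positivity)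
      (Finset.Ico s (s + T₀))).trans_eq hpow
  rw [hEY, hcard] at hdev
  have hcount : ∀ ω, ∑ t ∈ Finset.Ico s (s + T₀), Y (ω t) =
      T₀ - (collisionCount T₀ act ω s p : ℝ) := by
    intro ω
    have h1 : ∀ t ∈ Finset.Ico s (s + T₀), Y (ω t) =
        1 - ((if Collides (act t) (exploreArm ω t) p then 1 else 0 : ℕ) : ℝ) := by
      intro t ht
      rw [hact t ht]
      by_cases h : Collides S (exploreArm ω t) p
      · have h' : ω t ∉ A := fun h' => h' h
        simp [Y, h', if_pos h]
      · have h' : ω t ∈ A := h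
        simp [Y, h', if_neg h]
    rw [Finset.sum_congr rfl h1, Finset.sum_sub_distrib, collisionCount]
    simp
  have hsub : {ω | playerEstimate T₀ act ω s p ≠ S.card} ⊆
      {ω : ℕ → RoundSeed K M | (T₀ : ℝ) * (1 / (6 * K)) ≤
        1 * (∑ t ∈ Finset.Ico s (s + T₀), Y (ω t) - T₀ * (1 - 1 / (K : ℝ)) ^ (S.card - 1))} ∪
      {ω : ℕ → RoundSeed K M | (T₀ : ℝ) * (1 / (6 * K)) ≤
        -1 * (∑ t ∈ Finset.Ico s (s + T₀), Y (ω t) - T₀ * (1 - 1 / (K : ℝ)) ^ (S.card - 1))} := by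
    intro ω hω
    by_contra hcon
    rw [Set.mem_union, not_or] at hcon
    obtain ⟨h1, h2⟩ := hcon
    rw [Set.mem_ofPred_eq, not_le, hcount] at h1 h2
    apply hω
    have hx : |((T₀ : ℝ) - collisionCount T₀ act ω s p) / T₀ -
        (1 - 1 / (K : ℝ)) ^ (S.card - 1)| < 1 / (6 * K) := by
      rw [div_sub' hT0.ne', abs_div, abs_of_pos hT0, div_lt_iff₀ hT0, abs_lt]
      constructor <;> linarith
    obtain ⟨hx0, hr⟩ := round_log_div_log_eq (by omega) (by omega) hx
    -- A positive collision-free fraction rules out the special case in the definition of the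
    -- estimate.
    have hne : collisionCount T₀ act ω s p ≠ T₀ := by
      intro h
      rw [h] at hx0
      simp at hx0
    rw [playerEstimate, if_neg hne, hr]
    omega
  calc _ ≤ _ := measureReal_mono hsub
    _ ≤ _ := measureReal_union_le _ _
    _ ≤ Real.exp (-(T₀ / (18 * (K : ℝ) ^ 2))) + Real.exp (-(T₀ / (18 * (K : ℝ) ^ 2))) :=
      add_le_add (hdev 1 (by norm_num)) (hdev (-1) (by norm_num))
    _ = _ := by ring

end Estimate

/-! # Learning the ranking of the arms -/

section Ranking

variable {K M : ℕ}

theorem symm_lt_symm_ranking {m : Fin K → ℝ} {i j : Fin K} (h : m j < m i) :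
    (ranking m).symm i < (ranking m).symm j := by
  by_contra! hle
  have := Tuple.monotone_sort (fun i => -m i) hle
  simp only [ranking, Function.comp_apply, Equiv.apply_symm_apply] at this
  linarith

theorem isCorrectRanking_ranking {ε : ℝ} {μ m : Fin K → ℝ} (h : ∀ i, |m i - μ i| ≤ ε / 2) :
    IsCorrectRanking ε μ (ranking m) := by
  intro i j hij
  refine symm_lt_symm_ranking ?_
  have h1 := abs_le.1 (h i)
  have h2 := abs_le.1 (h j)
  linarith

variable (ν : Fin K → Measure ℝ) [∀ i, IsProbabilityMeasure (ν i)]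

/-- The exponential is 1 off `A` and `exp g` on `A`, and rewards are independent of draws, so the
expectation factorises. -/
theorem integrable_exp_indicator {A : Set (Fin M → Draw K)} {g : ℝ → ℝ} {i : Fin K}
    (hint : Integrable (fun x => Real.exp (g x)) (ν i)) :
    Integrable (fun x : RoundSeed K M => Real.exp (A.indicator 1 x.2 * g (x.1 i)))
      (roundLaw M ν) ∧
    ∫ x, Real.exp (A.indicator 1 x.2 * g (x.1 i)) ∂(roundLaw M ν) =
      1 + (∫ x, Real.exp (g x) ∂(ν i) - 1) * (drawsLaw K M).real A := by
  have hA : MeasurableSet A := .of_discrete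
  have hmp := measurePreserving_eval ν i
  have hint' : Integrable (fun y : Fin K → ℝ => Real.exp (g (y i)) - 1) (Measure.pi ν) :=
    (hmp.integrable_comp_of_integrable hint).sub (integrable_const _)
  have hind : Integrable (A.indicator (1 : (Fin M → Draw K) → ℝ)) (drawsLaw K M) :=
    (integrable_const (1 : ℝ)).indicator hA
  have heq : (fun x : RoundSeed K M => Real.exp (A.indicator 1 x.2 * g (x.1 i))) =
      fun x => 1 + (Real.exp (g (x.1 i)) - 1) * A.indicator 1 x.2 := by
    funext x
    by_cases h : x.2 ∈ A <;> simp [h]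
  have hprod : Integrable (fun x : RoundSeed K M =>
      (Real.exp (g (x.1 i)) - 1) * A.indicator 1 x.2) (roundLaw M ν) := by
    rw [roundLaw_eq_prod]
    exact hint'.mul_prod hind
  have hEg : ∫ y, Real.exp (g (y i)) ∂(Measure.pi ν) = ∫ x, Real.exp (g x) ∂(ν i) := by
    have h := integral_map (μ := Measure.pi ν) (φ := Function.eval i) hmp.measurable.aemeasurable
      (f := fun x => Real.exp (g x)) (by rw [hmp.map_eq]; exact hint.1)
    rw [hmp.map_eq] at h
    exact h.symm
  rw [heq]
  refine ⟨(integrable_const _).add hprod, ?_⟩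
  rw [integral_add (integrable_const _) hprod, roundLaw_eq_prod,
    integral_prod_mul (fun y : Fin K → ℝ => Real.exp (g (y i)) - 1) (A.indicator 1),
    integral_indicator_one hA, integral_sub (f := fun y : Fin K → ℝ => Real.exp (g (y i)))
      (hmp.integrable_comp_of_integrable hint) (integrable_const _), hEg]
  simp

variable [NeZero K]

/-- The number of observations of an arm is random. Rather than bounding it separately, one applies
Chernoff to the sum over all rounds, with unobserved rounds contributing 0. An observed round has
exponential moment at most `exp (-ε²/2) ≤ 1 - ε²/3`, and a round is an observed one with probability
at least `1/(3K)`. This gives the factor `1 - ε²/(9K)` per round. -/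
theorem gameLaw_real_le_observed_deviation_le
    (hν : ∀ i, ∀ᵐ x ∂(ν i), x ∈ Set.Icc (0 : ℝ) 1) {ε : ℝ} (hε : 0 < ε) (hε1 : ε ≤ 1)
    {S : Finset (Fin M)} {p : Fin M} (hp : p ∈ S) (hS : S.card ≤ K) (i : Fin K) (σ : ℝ)
    (hσ : σ ^ 2 = 1) (s : Finset ℕ) :
    (gameLaw M ν).real {ω | 0 ≤ ∑ t ∈ s, (observes S p i).indicator 1 (ω t).2 *
      (2 * ε * σ * ((ω t).1 i - meanReward ν i) - ε ^ 2)} ≤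
      Real.exp (-(s.card * ε ^ 2 / (9 * K))) := by
  have hK0 : (0 : ℝ) < K := by exact_mod_cast NeZero.pos K
  have hm : Measurable fun x : RoundSeed K M => (observes S p i).indicator 1 x.2 *
      (2 * ε * σ * (x.1 i - meanReward ν i) - ε ^ 2) := by
    have h1 : Measurable fun x : RoundSeed K M =>
        (observes S p i).indicator (1 : (Fin M → Draw K) → ℝ) x.2 :=
      (Measurable.of_discrete (f := (observes S p i).indicator (1 : (Fin M → Draw K) → ℝ))).comp
        measurable_snd
    have h2 : Measurable fun x : RoundSeed K M => x.1 i :=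
      (measurable_pi_apply i).comp measurable_fst
    fun_prop
  have hint : Integrable (fun x => Real.exp (2 * ε * σ * (x - meanReward ν i) - ε ^ 2)) (ν i) := by
    simp only [Real.exp_sub]
    exact (integrable_exp_mul_of_mem_Icc (ν i) aemeasurable_id (hν i) _ _).div_const _
  have hE : ∫ x, Real.exp (2 * ε * σ * (x - meanReward ν i) - ε ^ 2) ∂(ν i) ≤ 1 - ε ^ 2 / 3 := by
    refine (integral_exp_mul_sub_sub_le (ν i) aemeasurable_id (hν i) _ _).trans ?_
    have h1 : (2 * ε * σ) ^ 2 / 8 - ε ^ 2 = -(ε ^ 2 / 2) := by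
      rw [mul_pow, hσ]
      ring
    rw [h1, Real.exp_neg]
    have h2 := Real.add_one_le_exp (ε ^ 2 / 2)
    have h3 : ε ^ 2 ≤ 1 := pow_le_one₀ hε.le hε1
    have h4 : 0 < ε ^ 2 := by positivity
    calc (Real.exp (ε ^ 2 / 2))⁻¹ ≤ (ε ^ 2 / 2 + 1)⁻¹ := inv_anti₀ (by positivity) h2
      _ ≤ 1 - ε ^ 2 / 3 := by
        rw [inv_le_iff_one_le_mul₀ (by positivity)]
        nlinarith
  have hprob : 1 / (3 * (K : ℝ)) ≤ (drawsLaw K M).real (observes S p i) := by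
    rw [observes_eq]
    refine le_trans ?_ (le_drawsLaw_real_soleDraw (NeZero.pos K) le_rfl hp hS fun _ _ => i.isLt)
    rw [Real.exp_neg, inv_eq_one_div, div_div]
    have := Real.exp_one_lt_d9
    exact one_div_le_one_div_of_le (by positivity) (by gcongr; linarith)
  obtain ⟨hi1, hi2⟩ := integrable_exp_indicator ν (A := observes S p i) hint
  refine (infinitePi_real_sum_nonneg_le (roundLaw M ν) hm hi1
    (ρ := Real.exp (-(ε ^ 2 / (9 * K)))) ?_ s).trans_eq ?_
  · rw [hi2]
    have h1 : ε ^ 2 / (9 * K) = ε ^ 2 / 3 * (1 / (3 * K)) := by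
      field_simp
      norm_num
    have h2 := Real.add_one_le_exp (-(ε ^ 2 / (9 * K)))
    have h3 : ε ^ 2 / 3 * (1 / (3 * K)) ≤ ε ^ 2 / 3 * (drawsLaw K M).real (observes S p i) := by
      gcongr
    have h4 : 0 ≤ (drawsLaw K M).real (observes S p i) := measureReal_nonneg
    nlinarith
  · rw [← Real.exp_nat_mul]
    congr 1
    ring

theorem sum_observed_mul_eq {T₀ : ℕ} {act : ℕ → Finset (Fin M)} {S : Finset (Fin M)} {s : ℕ}
    (hact : ∀ t ∈ Finset.Ico s (s + T₀), act t = S) (ω : ℕ → RoundSeed K M) (p : Fin M)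
    (i : Fin K) (a b : ℝ) :
    ∑ t ∈ Finset.Ico s (s + T₀), (observes S p i).indicator 1 (ω t).2 * (a * (ω t).1 i - b) =
      a * rewardSum T₀ act ω s p i - b * observationCount T₀ act ω s p i := by
  rw [rewardSum, observationCount, Nat.cast_sum, Finset.mul_sum, Finset.mul_sum,
    ← Finset.sum_sub_distrib]
  refine Finset.sum_congr rfl fun t ht => ?_
  rw [hact t ht]
  by_cases h : exploreArm ω t p = i ∧ ¬ Collides S (exploreArm ω t) p
  · have h' : (ω t).2 ∈ observes S p i := h
    rw [if_pos h, if_pos h, Set.indicator_of_mem h']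
    simp
  · have h' : (ω t).2 ∉ observes S p i := h
    rw [if_neg h, if_neg h, Set.indicator_of_notMem h']
    simp

theorem gameLaw_real_not_isCorrectRanking_le
    (hν : ∀ i, ∀ᵐ x ∂(ν i), x ∈ Set.Icc (0 : ℝ) 1) {ε : ℝ} (hε : 0 < ε) (hε1 : ε ≤ 1)
    {T₀ : ℕ} {act : ℕ → Finset (Fin M)}
    {S : Finset (Fin M)} {s : ℕ} (hact : ∀ t ∈ Finset.Ico s (s + T₀), act t = S) {p : Fin M}
    (hp : p ∈ S) (hS : S.card ≤ K) :
    (gameLaw M ν).real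
      {ω | ¬ IsCorrectRanking ε (meanReward ν) (learnedRanking T₀ act ω s p)} ≤
      K * (2 * Real.exp (-(T₀ * ε ^ 2 / (9 * K)))) := by
  set B : ℝ → Fin K → Set (ℕ → RoundSeed K M) := fun σ i =>
    {ω | 0 ≤ ∑ t ∈ Finset.Ico s (s + T₀), (observes S p i).indicator 1 (ω t).2 *
      (2 * ε * σ * ((ω t).1 i - meanReward ν i) - ε ^ 2)} with hB
  have hBle : ∀ σ i, σ ^ 2 = 1 → (gameLaw M ν).real (B σ i) ≤
      Real.exp (-(T₀ * ε ^ 2 / (9 * K))) := fun σ i hσ => by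
    simpa using gameLaw_real_le_observed_deviation_le ν hν hε hε1 hp hS i σ hσ
      (Finset.Ico s (s + T₀))
  have hsub : {ω | ¬ IsCorrectRanking ε (meanReward ν) (learnedRanking T₀ act ω s p)} ⊆
      ⋃ i ∈ (Finset.univ : Finset (Fin K)), (B 1 i ∪ B (-1) i) := by
    intro ω hω
    by_contra hcon
    simp only [Finset.mem_univ, Set.iUnion_true, Set.mem_iUnion, Set.mem_union, not_exists,
      not_or] at hcon
    refine hω (isCorrectRanking_ranking fun i => ?_)
    have hval : ∀ σ, ω ∉ B σ i → 2 * ε * σ * rewardSum T₀ act ω s p i -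
        (2 * ε * σ * meanReward ν i + ε ^ 2) * observationCount T₀ act ω s p i < 0 := by
      intro σ h
      rw [← sum_observed_mul_eq hact]
      rw [hB, Set.mem_ofPred_eq, not_le] at h
      refine lt_of_eq_of_lt (Finset.sum_congr rfl fun t _ => ?_) h
      ring
    have h1 := hval 1 (hcon i).1
    have h2 := hval (-1) (hcon i).2
    -- Without observations both sums would be 0, hence not negative. So the good event already
    -- forces an observation, and the default value of the empirical mean plays no role.
    have hO : (0 : ℝ) < observationCount T₀ act ω s p i := by
      rcases Nat.eq_zero_or_pos (observationCount T₀ act ω s p i) with h | h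
      · rw [h] at h1 h2
        norm_num at h1 h2
        linarith
      · exact_mod_cast h
    rw [empiricalMean, div_sub' hO.ne', abs_div, abs_of_pos hO, div_le_iff₀ hO, abs_le]
    have h3 : (2 * ε) * (rewardSum T₀ act ω s p i - meanReward ν i *
        observationCount T₀ act ω s p i - ε / 2 * observationCount T₀ act ω s p i) < 0 := by
      linarith
    have h4 : (2 * ε) * (-(rewardSum T₀ act ω s p i) + meanReward ν i *
        observationCount T₀ act ω s p i - ε / 2 * observationCount T₀ act ω s p i) < 0 := by
      linarith
    have h5 := neg_of_mul_neg_right h3 (by positivity)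
    have h6 := neg_of_mul_neg_right h4 (by positivity)
    constructor <;> linarith
  calc _ ≤ _ := measureReal_mono hsub (measure_ne_top _ _)
    _ ≤ _ := measureReal_biUnion_finset_le _ _
    _ ≤ ∑ _i : Fin K, 2 * Real.exp (-(T₀ * ε ^ 2 / (9 * K))) := by
      refine Finset.sum_le_sum fun i _ => (measureReal_union_le _ _).trans ?_
      linarith [hBle 1 i (by norm_num), hBle (-1) i (by norm_num)]
    _ = _ := by simp

theorem gameLaw_real_compl_learnsAt_le
    (hν : ∀ i, ∀ᵐ x ∂(ν i), x ∈ Set.Icc (0 : ℝ) 1) {ε : ℝ} (hε : 0 < ε) (hε1 : ε ≤ 1)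
    {T₀ : ℕ} (hT₀ : 0 < T₀) {act : ℕ → Finset (Fin M)}
    {S : Finset (Fin M)} {s : ℕ} (hact : ∀ t ∈ Finset.Ico s (s + T₀), act t = S)
    (hS : S.card < K) :
    (gameLaw M ν).real (learnsAt T₀ act ε (meanReward ν) S s)ᶜ ≤
      K * (K * (2 * Real.exp (-(T₀ * ε ^ 2 / (9 * K)))) +
        2 * Real.exp (-(T₀ / (18 * (K : ℝ) ^ 2)))) := by
  have hsub : (learnsAt T₀ act ε (meanReward ν) S s)ᶜ ⊆ ⋃ p ∈ S,
      ({ω | ¬ IsCorrectRanking ε (meanReward ν) (learnedRanking T₀ act ω s p)} ∪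
        {ω | playerEstimate T₀ act ω s p ≠ S.card}) := by
    intro ω hω
    simp only [learnsAt, Set.mem_compl_iff, Set.mem_ofPred_eq, not_forall] at hω
    obtain ⟨p, hp, h⟩ := hω
    simp only [Set.mem_iUnion, Set.mem_union, Set.mem_ofPred_eq]
    exact ⟨p, hp, by tauto⟩
  calc _ ≤ _ := measureReal_mono hsub (measure_ne_top _ _)
    _ ≤ _ := measureReal_biUnion_finset_le _ _
    _ ≤ ∑ _p ∈ S, (K * (2 * Real.exp (-(T₀ * ε ^ 2 / (9 * K)))) +
        2 * Real.exp (-(T₀ / (18 * (K : ℝ) ^ 2)))) := by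
      refine Finset.sum_le_sum fun p hp => (measureReal_union_le _ _).trans ?_
      exact add_le_add (gameLaw_real_not_isCorrectRanking_le ν hν hε hε1 hact hp hS.le)
        (gameLaw_real_playerEstimate_ne_le ν hT₀ hact hp hS)
    _ ≤ _ := by
      rw [Finset.sum_const, nsmul_eq_mul]
      gcongr

end Ranking


/-! # The best arms -/

section Best

variable {K : ℕ}

/-- The set of the `N` best arms. -/
def bestArms (μ : Fin K → ℝ) (N : ℕ) : Finset (Fin K) := {i | ((ranking μ).symm i : ℕ) < N}

theorem mem_bestArms {μ : Fin K → ℝ} {N : ℕ} {i : Fin K} :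
    i ∈ bestArms μ N ↔ ((ranking μ).symm i : ℕ) < N := by
  simp [bestArms]

theorem card_filter_val_lt {N : ℕ} (hN : N ≤ K) :
    (Finset.univ.filter fun k : Fin K => (k : ℕ) < N).card = N := by
  have := Fin.card_filter_val_lt (n := K) (m := N)
  simpa [hN] using this

theorem card_bestArms (μ : Fin K → ℝ) {N : ℕ} (hN : N ≤ K) : (bestArms μ N).card = N := by
  refine (Finset.card_bij (fun i _ => (ranking μ).symm i) ?_ ?_ ?_).trans (card_filter_val_lt hN)
  · intro i hi
    simpa [mem_bestArms] using hi
  · intro i _ j _ h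
    exact (ranking μ).symm.injective h
  · intro k hk
    exact ⟨ranking μ k, by simpa [mem_bestArms] using hk, by simp⟩

theorem sum_bestArms (μ : Fin K → ℝ) (N : ℕ) :
    (∑ i : Fin K, if (i : ℕ) < N then μ (ranking μ i) else 0) = ∑ i ∈ bestArms μ N, μ i := by
  rw [bestArms, Finset.sum_filter, ← Equiv.sum_comp (ranking μ)
    fun i => if ((ranking μ).symm i : ℕ) < N then μ i else 0]
  simp only [Equiv.symm_apply_apply]

theorem antitone_comp_ranking (μ : Fin K → ℝ) {i j : Fin K} (h : i ≤ j) :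
    μ (ranking μ j) ≤ μ (ranking μ i) := by
  have := Tuple.monotone_sort (fun i => -μ i) h
  simpa [ranking] using this

theorem gap_lt_of_mem_bestArms {ε : ℝ} {μ : Fin K → ℝ} {Nm N : ℕ} (hgap : GapsExceed ε Nm μ)
    (hN : N ≤ Nm) {i j : Fin K} (hi : i ∈ bestArms μ N) (hj : j ∉ bestArms μ N) :
    ε < μ i - μ j := by
  rw [mem_bestArms] at hi hj
  have hjK := ((ranking μ).symm j).isLt
  have h := hgap (N - 1) (by omega) (by omega)
  have h1 := antitone_comp_ranking μ (i := (ranking μ).symm i) (j := ⟨N - 1, by omega⟩)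
    (Fin.mk_le_mk.2 (by omega) : (⟨_, ((ranking μ).symm i).isLt⟩ : Fin K) ≤ _)
  have h2 := antitone_comp_ranking μ (i := ⟨N - 1 + 1, by omega⟩) (j := (ranking μ).symm j)
    (Fin.mk_le_mk.2 (by omega) : _ ≤ (⟨_, ((ranking μ).symm j).isLt⟩ : Fin K))
  rw [Equiv.apply_symm_apply] at h1 h2
  linarith

/-- A correct ranking may shuffle arms with close means, but not across the gap after position `N`.
If a best arm were missing from the first `N` places, no other arm could occupy one of them, so
these places would hold best arms only; by cardinality they would hold all of them. -/
theorem symm_lt_iff_mem_bestArms {ε : ℝ} {μ : Fin K → ℝ} {Nm N : ℕ} (hgap : GapsExceed ε Nm μ)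
    (hN : N ≤ Nm) (hK : N ≤ K) {A : Equiv.Perm (Fin K)} (hA : IsCorrectRanking ε μ A)
    (i : Fin K) : (A.symm i : ℕ) < N ↔ i ∈ bestArms μ N := by
  set F : Finset (Fin K) := {i | (A.symm i : ℕ) < N} with hF
  have hcard : F.card = N := by
    refine (Finset.card_bij (fun i _ => A.symm i) ?_ ?_ ?_).trans (card_filter_val_lt hK)
    · intro i hi
      simpa [F] using hi
    · intro i _ j _ h
      exact A.symm.injective h
    · intro k hk
      exact ⟨A k, by simpa [F] using hk, by simp⟩
  have hsub : bestArms μ N ⊆ F := by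
    by_contra hcon
    obtain ⟨i, hi, hiF⟩ := Finset.not_subset.1 hcon
    have hFB : F ⊆ bestArms μ N := by
      intro j hj
      by_contra hjB
      have := hA i j (gap_lt_of_mem_bestArms hgap hN hi hjB)
      simp only [hF, Finset.mem_filter, Finset.mem_univ, true_and, not_lt] at hiF hj
      have h' : (A.symm i : ℕ) < A.symm j := this
      omega
    exact hiF (Finset.eq_of_subset_of_card_le hFB (by rw [hcard, card_bestArms μ hK]) ▸ hi)
  have heq := Finset.eq_of_subset_of_card_le hsub (by rw [hcard, card_bestArms μ hK])
  rw [heq]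
  simp [F]

theorem GapsExceed.le_one {ε : ℝ} {Nm : ℕ} {μ : Fin K → ℝ} (hμ : ∀ i, μ i ∈ Set.Icc (0 : ℝ) 1)
    (h : GapsExceed ε Nm μ) (hNm0 : 0 < Nm) (hNm : Nm < K) : ε ≤ 1 := by
  have h1 := h 0 hNm0 (by omega)
  linarith [(hμ (ranking μ ⟨0, by omega⟩)).2, (hμ (ranking μ ⟨0 + 1, by omega⟩)).1]

end Best

/-! # One epoch of musical chairs -/

section Chairs

variable {K M : ℕ} [NeZero K] {T₀ T₁ : ℕ} {act : ℕ → Finset (Fin M)}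

/-- The players of `S` are present in all rounds of the `m`-th epoch before round `H`. -/
structure IsQuiet (T₁ : ℕ) (act : ℕ → Finset (Fin M)) (S : Finset (Fin M)) (m H : ℕ) : Prop where
  le : H ≤ T₁ * m + T₁
  act_eq : ∀ t, T₁ * m ≤ t → t < H → act t = S

namespace IsQuiet

variable {S : Finset (Fin M)} {m H : ℕ} {ω : ℕ → RoundSeed K M}

theorem div_eq (h : IsQuiet T₁ act S m H) {t : ℕ} (h1 : T₁ * m ≤ t) (h2 : t < H) :
    t / T₁ = m := by
  have := h.le
  refine Nat.div_eq_of_lt_le (by rw [mul_comm]; exact h1) ?_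
  rw [mul_comm, Nat.mul_add, mul_one]
  omega

theorem mod_eq (h : IsQuiet T₁ act S m H) {t : ℕ} (h1 : T₁ * m ≤ t) (h2 : t < H) :
    t % T₁ = t - T₁ * m := by
  have h3 := Nat.div_add_mod t T₁
  rw [h.div_eq h1 h2] at h3
  omega

theorem epochStart_eq (h : IsQuiet T₁ act S m H) {t : ℕ} (h1 : T₁ * m ≤ t) (h2 : t < H) :
    epochStart T₁ t = T₁ * m := by
  rw [epochStart, h.div_eq h1 h2]

theorem inChairs_iff (h : IsQuiet T₁ act S m H) {t : ℕ} (h1 : T₁ * m + T₀ ≤ t) (h2 : t < H)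
    (p : Fin M) : InChairs T₀ T₁ act t p ↔ p ∈ S := by
  have h3 : T₁ * m ≤ t := by omega
  rw [InChairs, h.epochStart_eq h3 h2, h.mod_eq h3 h2]
  constructor
  · rintro ⟨-, h4⟩
    rw [← h.act_eq t h3 h2]
    exact h4 t (Finset.mem_Icc.2 ⟨h3, le_rfl⟩)
  · intro hp
    refine ⟨by omega, fun s hs => ?_⟩
    rw [Finset.mem_Icc] at hs
    rwa [h.act_eq s hs.1 (by omega)]

theorem fixedArm_start (h : IsQuiet T₁ act S m H) (hT₀ : 0 < T₀) (h2 : T₁ * m + T₀ < H)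
    (p : Fin M) : fixedArm T₀ T₁ act ω (T₁ * m + T₀) p = none := by
  obtain ⟨k, rfl⟩ : ∃ k, T₀ = k + 1 := ⟨T₀ - 1, by omega⟩
  have hk : T₁ * m + k < H := by omega
  rw [← add_assoc, fixedArm]
  dsimp only
  rw [if_pos]
  refine Or.inr fun hc => ?_
  have := hc.1
  rw [h.mod_eq (by omega) hk] at this
  omega

theorem fixedArm_succ_of_notMem (h : IsQuiet T₁ act S m H) {t : ℕ} (h1 : T₁ * m + T₀ ≤ t)
    (h2 : t + 1 < H) {p : Fin M} (hp : p ∉ S) : fixedArm T₀ T₁ act ω (t + 1) p = none := by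
  rw [fixedArm]
  dsimp only
  rw [if_pos]
  exact Or.inr (by rwa [h.inChairs_iff h1 (by omega)])

theorem fixedArm_succ_of_mem (h : IsQuiet T₁ act S m H) {t : ℕ} (h1 : T₁ * m + T₀ ≤ t)
    (h2 : t + 1 < H) {p : Fin M} (hp : p ∈ S) : fixedArm T₀ T₁ act ω (t + 1) p =
      match fixedArm T₀ T₁ act ω t p with
      | some i => some i
      | none => if Collides S (arm T₀ T₁ act ω t) p then none else some (arm T₀ T₁ act ω t p) := by
  rw [fixedArm]
  dsimp only
  rw [if_neg, h.act_eq t (by omega) (by omega)]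
  · rfl
  · rw [h.mod_eq (by omega) h2, h.inChairs_iff h1 (by omega)]
    simp only [not_or, not_not]
    exact ⟨by omega, hp⟩

theorem arm_of_fixed (h : IsQuiet T₁ act S m H) {t : ℕ} (h1 : T₁ * m + T₀ ≤ t) (h2 : t < H)
    {p : Fin M} (hp : p ∈ S) {i : Fin K} (hi : fixedArm T₀ T₁ act ω t p = some i) :
    arm T₀ T₁ act ω t p = i := by
  rw [arm, chooseArm, if_pos ((h.inChairs_iff h1 h2 p).2 hp), hi]

variable {ε : ℝ} {μ : Fin K → ℝ}

theorem arm_of_not_fixed (h : IsQuiet T₁ act S m H) {t : ℕ} (h1 : T₁ * m + T₀ ≤ t) (h2 : t < H)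
    (hω : ω ∈ learnsAt T₀ act ε μ S (T₁ * m)) {p : Fin M} (hp : p ∈ S)
    (hi : fixedArm T₀ T₁ act ω t p = none) :
    arm T₀ T₁ act ω t p =
      learnedRanking T₀ act ω (T₁ * m) p (sampleBelow ((ω t).2 p) S.card) := by
  rw [arm, chooseArm, if_pos ((h.inChairs_iff h1 h2 p).2 hp), hi,
    h.epochStart_eq (by omega) h2]
  simp only [(hω p hp).2]

theorem sampleBelow_lt (d : Draw K) {n : ℕ} (hn : 0 < n) : (sampleBelow d n : ℕ) < n := by
  have h := (d ⟨min n K - 1, by have := NeZero.pos K; omega⟩).isLt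
  have := NeZero.pos K
  simp only [sampleBelow, Fin.val_castLE] at h ⊢
  omega

variable {Nm : ℕ}

theorem arm_mem_bestArms_of_not_fixed (h : IsQuiet T₁ act S m H) (hgap : GapsExceed ε Nm μ)
    (hS : S.card ≤ Nm) (hK : S.card ≤ K) {t : ℕ} (h1 : T₁ * m + T₀ ≤ t) (h2 : t < H)
    (hω : ω ∈ learnsAt T₀ act ε μ S (T₁ * m)) {p : Fin M} (hp : p ∈ S)
    (hi : fixedArm T₀ T₁ act ω t p = none) :
    arm T₀ T₁ act ω t p ∈ bestArms μ S.card := by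
  rw [h.arm_of_not_fixed h1 h2 hω hp hi,
    ← symm_lt_iff_mem_bestArms hgap hS hK (hω p hp).1, Equiv.symm_apply_apply]
  exact sampleBelow_lt _ (Finset.card_pos.2 ⟨p, hp⟩)

/-- The invariant of musical chairs: occupied arms are best arms and pairwise distinct. Fixed
players keep playing their arms, so a newcomer to an arm becomes fixed only by not colliding with
its occupant or with another candidate. -/
theorem fixedArm_spec (h : IsQuiet T₁ act S m H) (hT₀ : 0 < T₀) (hgap : GapsExceed ε Nm μ)
    (hS : S.card ≤ Nm) (hK : S.card ≤ K) (hω : ω ∈ learnsAt T₀ act ε μ S (T₁ * m)) {t : ℕ}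
    (h1 : T₁ * m + T₀ ≤ t) (h2 : t < H) :
    (∀ p i, fixedArm T₀ T₁ act ω t p = some i → p ∈ S ∧ i ∈ bestArms μ S.card) ∧
      ∀ p q i, fixedArm T₀ T₁ act ω t p = some i → fixedArm T₀ T₁ act ω t q = some i → p = q := by
  induction t, h1 using Nat.le_induction with
  | base => simp [h.fixedArm_start hT₀ h2]
  | succ t h1 ih =>
    obtain ⟨ih1, ih2⟩ := ih (by omega)
    have key : ∀ p i, fixedArm T₀ T₁ act ω (t + 1) p = some i →
        p ∈ S ∧ arm T₀ T₁ act ω t p = i ∧ (fixedArm T₀ T₁ act ω t p = some i ∨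
          (fixedArm T₀ T₁ act ω t p = none ∧ ¬ Collides S (arm T₀ T₁ act ω t) p)) := by
      intro p i hp
      by_cases hpS : p ∈ S
      · refine ⟨hpS, ?_⟩
        rw [h.fixedArm_succ_of_mem h1 h2 hpS] at hp
        cases hf : fixedArm T₀ T₁ act ω t p with
        | some j =>
          simp only [hf, Option.some.injEq] at hp
          subst hp
          exact ⟨h.arm_of_fixed h1 (by omega) hpS hf, Or.inl rfl⟩
        | none =>
          simp only [hf] at hp
          split_ifs at hp with hc
          exact ⟨Option.some.inj hp, Or.inr ⟨rfl, hc⟩⟩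
      · rw [h.fixedArm_succ_of_notMem h1 h2 hpS] at hp
        exact absurd hp (by simp)
    constructor
    · intro p i hp
      obtain ⟨hpS, harm, hf | ⟨hf, -⟩⟩ := key p i hp
      · exact ih1 p i hf
      · exact ⟨hpS, harm ▸ h.arm_mem_bestArms_of_not_fixed hgap hS hK h1 (by omega) hω hpS hf⟩
    · intro p q i hp hq
      obtain ⟨hpS, hparm, hpf⟩ := key p i hp
      obtain ⟨hqS, hqarm, hqf⟩ := key q i hq
      by_contra hne
      rcases hpf with hpf | ⟨-, hpc⟩
      · rcases hqf with hqf | ⟨-, hqc⟩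
        · exact hne (ih2 p q i hpf hqf)
        · exact hqc ⟨p, hpS, hne, hparm.trans hqarm.symm⟩
      · exact hpc ⟨q, hqS, Ne.symm hne, hqarm.trans hparm.symm⟩

/-- Pigeonhole: if all best arms were occupied, their occupants would be `S.card` distinct players
of `S` other than `p`. -/
theorem exists_free_arm (h : IsQuiet T₁ act S m H) (hT₀ : 0 < T₀) (hgap : GapsExceed ε Nm μ)
    (hS : S.card ≤ Nm) (hK : S.card ≤ K) (hω : ω ∈ learnsAt T₀ act ε μ S (T₁ * m)) {t : ℕ}
    (h1 : T₁ * m + T₀ ≤ t) (h2 : t < H) {p : Fin M} (hp : p ∈ S)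
    (hpf : fixedArm T₀ T₁ act ω t p = none) :
    ∃ i ∈ bestArms μ S.card, ∀ q, fixedArm T₀ T₁ act ω t q ≠ some i := by
  by_contra! hcon
  obtain ⟨hs1, -⟩ := h.fixedArm_spec hT₀ hgap hS hK hω h1 h2
  have : Nonempty (Fin M) := ⟨p⟩
  choose! g hg using hcon
  have hle : (bestArms μ S.card).card ≤ (S.erase p).card := by
    refine Finset.card_le_card_of_injOn g ?_ ?_
    · intro i hi
      refine Finset.mem_coe.2 (Finset.mem_erase.2 ⟨?_, (hs1 _ i (hg i hi)).1⟩)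
      intro heq
      have := hg i hi
      rw [heq, hpf] at this
      exact absurd this (by simp)
    · intro i hi j hj heq
      have h3 := hg i hi
      rw [heq, hg j hj] at h3
      exact (Option.some.inj h3).symm
  rw [card_bestArms μ hK, Finset.card_erase_of_mem hp] at hle
  have := Finset.card_pos.2 ⟨p, hp⟩
  omega

/-- If every player of `S` is fixed, then there is no regret. -/
theorem roundRegret_eq_zero (h : IsQuiet T₁ act S m H) (hT₀ : 0 < T₀) (hgap : GapsExceed ε Nm μ)
    (hS : S.card ≤ Nm) (hK : S.card ≤ K) (hω : ω ∈ learnsAt T₀ act ε μ S (T₁ * m)) {t : ℕ}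
    (h1 : T₁ * m + T₀ ≤ t) (h2 : t < H) (hf : ∀ p ∈ S, fixedArm T₀ T₁ act ω t p ≠ none) :
    roundRegret T₀ T₁ act μ ω t = 0 := by
  obtain ⟨hs1, hs2⟩ := h.fixedArm_spec hT₀ hgap hS hK hω h1 h2
  have harm : ∀ p ∈ S, fixedArm T₀ T₁ act ω t p = some (arm T₀ T₁ act ω t p) := by
    intro p hp
    obtain ⟨i, hi⟩ := Option.ne_none_iff_exists'.1 (hf p hp)
    rw [hi, h.arm_of_fixed h1 h2 hp hi]
  have hinj : Set.InjOn (arm T₀ T₁ act ω t) S := by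
    intro p hp q hq heq
    exact hs2 p q _ (harm p hp) (by rw [heq]; exact harm q hq)
  rw [roundRegret, h.act_eq t (by omega) h2, sum_bestArms, sub_eq_zero]
  have himg : S.image (arm T₀ T₁ act ω t) = bestArms μ S.card := by
    refine Finset.eq_of_subset_of_card_le ?_ ?_
    · intro i hi
      obtain ⟨p, hp, rfl⟩ := Finset.mem_image.1 hi
      exact (hs1 p _ (harm p hp)).2
    · rw [card_bestArms μ hK, Finset.card_image_of_injOn hinj]
  rw [← himg, Finset.sum_image hinj]
  refine Finset.sum_congr rfl fun p hp => ?_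
  rw [if_neg]
  rintro ⟨q, hq, hne, heq⟩
  exact hne (hinj hq hp heq)

/-- The learning before the musical chairs succeeds, and `p` is not yet fixed at the beginning of
round `t`. -/
def _root_.MusicalChairs.unfixed (T₀ T₁ : ℕ) (act : ℕ → Finset (Fin M)) (ε : ℝ) (μ : Fin K → ℝ)
    (S : Finset (Fin M)) (m t : ℕ) (p : Fin M) : Set (ℕ → RoundSeed K M) :=
  learnsAt T₀ act ε μ S (T₁ * m) ∩ {ω | fixedArm T₀ T₁ act ω t p = none}

theorem _root_.MusicalChairs.measurableSet_unfixed (T₀ T₁ : ℕ) (act : ℕ → Finset (Fin M)) (ε : ℝ)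
    (μ : Fin K → ℝ) (S : Finset (Fin M)) (m t : ℕ) (p : Fin M) :
    MeasurableSet (unfixed T₀ T₁ act ε μ S m t p) :=
  (measurableSet_learnsAt ..).inter
    (measurable_fixedArm T₀ T₁ act t (.of_discrete (s := {F : Fin M → Option (Fin K) | F p = none})))

variable (ν : Fin K → Measure ℝ) [∀ i, IsProbabilityMeasure (ν i)]

/-- The relevant past is the fixed arms and the rankings, which take finitely many values and
determine a free best arm. If `p` draws this arm and nobody else draws it, then `p` becomes fixed.
-/
theorem gameLaw_real_unfixed_succ_le (h : IsQuiet T₁ act S m H) (hT₀ : 0 < T₀)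
    (hgap : GapsExceed ε Nm μ) (hS : S.card ≤ Nm) (hK : S.card ≤ K) {t : ℕ}
    (h1 : T₁ * m + T₀ ≤ t) (h2 : t + 1 < H) {p : Fin M} (hp : p ∈ S) :
    (gameLaw M ν).real (unfixed T₀ T₁ act ε μ S m (t + 1) p) ≤
      (1 - Real.exp (-1) / K) * (gameLaw M ν).real (unfixed T₀ T₁ act ε μ S m t p) := by
  classical
  have ht : t < H := by omega
  let D : (ℕ → RoundSeed K M) → (Fin M → Option (Fin K)) × (Fin M → Equiv.Perm (Fin K)) :=
    fun ω => (fixedArm T₀ T₁ act ω t, learnedRanking T₀ act ω (T₁ * m))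
  have hDm : Measurable D := (measurable_fixedArm T₀ T₁ act t).prodMk
    (measurable_pi_lambda _ fun q => measurable_learnedRanking T₀ act (T₁ * m) q)
  -- The default arm `0` is never used on the event in question, where a free arm exists.
  let free : (Fin M → Option (Fin K)) → Fin K := fun F =>
    if hF : ∃ i ∈ bestArms μ S.card, ∀ q, F q ≠ some i then hF.choose else 0
  have hfree : ∀ ω ∈ unfixed T₀ T₁ act ε μ S m t p,
      free (fixedArm T₀ T₁ act ω t) ∈ bestArms μ S.card ∧
        ∀ q, fixedArm T₀ T₁ act ω t q ≠ some (free (fixedArm T₀ T₁ act ω t)) := by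
    rintro ω ⟨hω, hpf⟩
    have hex := h.exists_free_arm hT₀ hgap hS hK hω h1 ht hp hpf
    simp only [free, dif_pos hex]
    exact hex.choose_spec
  -- Draws of already fixed players are restricted too, although they are ignored by the algorithm;
  -- this only shrinks the event and keeps its probability explicit.
  let W : (Fin M → Option (Fin K)) × (Fin M → Equiv.Perm (Fin K)) → Set (Fin M → Draw K) :=
    fun z => {d | (sampleBelow (d p) S.card : ℕ) = (fun q => ((z.2 q).symm (free z.1) : ℕ)) p ∧
      ∀ q ∈ S, q ≠ p →
        (sampleBelow (d q) S.card : ℕ) ≠ (fun q => ((z.2 q).symm (free z.1) : ℕ)) q}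
  have hsub : unfixed T₀ T₁ act ε μ S m (t + 1) p ⊆
      {ω | ω ∈ unfixed T₀ T₁ act ε μ S m t p ∧ ω t ∉ {x : RoundSeed K M | x.2 ∈ W (D ω)}} := by
    rintro ω ⟨hω, hpf⟩
    rw [Set.mem_ofPred_eq, h.fixedArm_succ_of_mem h1 h2 hp] at hpf
    have hpf' : fixedArm T₀ T₁ act ω t p = none := by
      cases hf : fixedArm T₀ T₁ act ω t p with
      | some j => simp [hf] at hpf
      | none => rfl
    have hmem : ω ∈ unfixed T₀ T₁ act ε μ S m t p := ⟨hω, hpf'⟩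
    refine ⟨hmem, ?_⟩
    rintro ⟨hw1, hw2⟩
    have hfr := (hfree ω hmem).2
    set i := free (fixedArm T₀ T₁ act ω t) with hi
    simp only [hpf'] at hpf
    have harmp : arm T₀ T₁ act ω t p = i := by
      rw [h.arm_of_not_fixed h1 ht hω hp hpf', ← Equiv.eq_symm_apply]
      exact Fin.ext hw1
    rw [if_neg] at hpf
    · exact absurd hpf (by simp)
    rintro ⟨q, hq, hne, heq⟩
    rw [harmp] at heq
    cases hf : fixedArm T₀ T₁ act ω t q with
    | some j =>
      rw [h.arm_of_fixed h1 ht hq hf] at heq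
      exact hfr q (heq ▸ hf)
    | none =>
      rw [h.arm_of_not_fixed h1 ht hω hq hf, ← Equiv.eq_symm_apply] at heq
      exact hw2 q hq hne (congrArg Fin.val heq)
  refine (measureReal_mono hsub (measure_ne_top _ _)).trans ?_
  refine infinitePi_real_miss_le (roundLaw M ν) (measurableSet_unfixed ..) ?_
    (D := D) (fun d => hDm (.of_discrete (s := {d}))) ?_
    (S := fun z => {x : RoundSeed K M | x.2 ∈ W z}) (fun z => measurable_snd .of_discrete) ?_
  · intro ω ω' hωω'
    have e1 : ω ∈ learnsAt T₀ act ε μ S (T₁ * m) ↔ ω' ∈ learnsAt T₀ act ε μ S (T₁ * m) :=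
      learnsAt_congr fun s hs => hωω' s (Set.mem_Iio.2 (by omega))
    have e2 := fixedArm_congr (T₀ := T₀) (T₁ := T₁) (act := act)
      fun s hs => hωω' s (Set.mem_Iio.2 hs)
    simp only [unfixed, Set.mem_inter_iff, Set.mem_ofPred_eq, e1, e2]
  · intro ω ω' hωω'
    refine Prod.ext ?_ ?_
    · exact fixedArm_congr fun s hs => hωω' s (Set.mem_Iio.2 hs)
    · exact learnedRanking_congr fun s hs => hωω' s (Set.mem_Iio.2 (by omega))
  · intro ω hω
    rw [roundLaw_real_snd_mem ν (W (D ω))]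
    refine le_drawsLaw_real_soleDraw (Finset.card_pos.2 ⟨p, hp⟩) hK hp le_rfl
      (pos := fun q => (((D ω).2 q).symm (free (D ω).1) : ℕ)) fun q hq => ?_
    exact (symm_lt_iff_mem_bestArms hgap hS hK (hω.1 q hq).1 _).2 (hfree ω hω).1

theorem gameLaw_real_unfixed_le (h : IsQuiet T₁ act S m H) (hT₀ : 0 < T₀)
    (hgap : GapsExceed ε Nm μ) (hS : S.card ≤ Nm) (hK : S.card ≤ K) (j : ℕ)
    (h2 : T₁ * m + T₀ + j < H) {p : Fin M} (hp : p ∈ S) :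
    (gameLaw M ν).real (unfixed T₀ T₁ act ε μ S m (T₁ * m + T₀ + j) p) ≤
      (1 - Real.exp (-1) / K) ^ j := by
  have hK1 : (1 : ℝ) ≤ K := by exact_mod_cast NeZero.pos K
  have hc : 0 ≤ 1 - Real.exp (-1) / K := by
    rw [sub_nonneg]
    refine div_le_one_of_le₀ (le_trans ?_ hK1) (by positivity)
    exact Real.exp_le_one_iff.2 (by norm_num)
  induction j with
  | zero => simp
  | succ j ih =>
    refine (h.gameLaw_real_unfixed_succ_le ν hT₀ hgap hS hK (t := T₁ * m + T₀ + j) (by omega) h2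
      hp).trans ?_
    rw [pow_succ']
    exact mul_le_mul_of_nonneg_left (ih (by omega)) hc

end IsQuiet

end Chairs


/-! # The regret of a run -/

section Regret

variable {K M : ℕ}

theorem meanReward_mem_Icc {ν : Fin K → Measure ℝ} [∀ i, IsProbabilityMeasure (ν i)]
    (hν : ∀ i, ∀ᵐ x ∂(ν i), x ∈ Set.Icc (0 : ℝ) 1) (i : Fin K) :
    meanReward ν i ∈ Set.Icc (0 : ℝ) 1 := by
  have hint : Integrable (fun x : ℝ => x) (ν i) := by
    refine Integrable.of_bound aestronglyMeasurable_id 1 ?_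
    filter_upwards [hν i] with x hx
    rw [Real.norm_eq_abs, abs_of_nonneg hx.1]
    exact hx.2
  constructor
  · refine integral_nonneg_of_ae ?_
    filter_upwards [hν i] with x hx using hx.1
  · calc meanReward ν i ≤ ∫ _, (1 : ℝ) ∂(ν i) := by
          refine integral_mono_ae hint (integrable_const _) ?_
          filter_upwards [hν i] with x hx using hx.2
      _ = 1 := by simp

variable [NeZero K] {T₀ T₁ : ℕ} {act : ℕ → Finset (Fin M)} {μ : Fin K → ℝ}

theorem abs_roundRegret_le (hμ : ∀ i, μ i ∈ Set.Icc (0 : ℝ) 1) {t : ℕ} (hK : (act t).card ≤ K)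
    (ω : ℕ → RoundSeed K M) : |roundRegret T₀ T₁ act μ ω t| ≤ K := by
  have hK' : ((act t).card : ℝ) ≤ K := by exact_mod_cast hK
  have h1 : 0 ≤ ∑ i ∈ bestArms μ (act t).card, μ i := Finset.sum_nonneg fun i _ => (hμ i).1
  have h2 : ∑ i ∈ bestArms μ (act t).card, μ i ≤ (act t).card := by
    have := Finset.sum_le_card_nsmul (bestArms μ (act t).card) μ 1 fun i _ => (hμ i).2
    rwa [card_bestArms μ hK, nsmul_eq_mul, mul_one] at this
  have h3 : 0 ≤ ∑ p ∈ act t,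
      if Collides (act t) (arm T₀ T₁ act ω t) p then 0 else μ (arm T₀ T₁ act ω t p) := by
    refine Finset.sum_nonneg fun p _ => ?_
    split_ifs
    · exact le_rfl
    · exact (hμ _).1
  have h4 : (∑ p ∈ act t,
      if Collides (act t) (arm T₀ T₁ act ω t) p then 0 else μ (arm T₀ T₁ act ω t p)) ≤
      (act t).card := by
    have := Finset.sum_le_card_nsmul (act t) (fun p =>
      if Collides (act t) (arm T₀ T₁ act ω t) p then 0 else μ (arm T₀ T₁ act ω t p)) 1 fun p _ => by
        split_ifs
        · exact zero_le_one
        · exact (hμ _).2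
    rwa [nsmul_eq_mul, mul_one] at this
  rw [roundRegret, sum_bestArms, abs_le]
  constructor <;> linarith

variable {ν : Fin K → Measure ℝ} [∀ i, IsProbabilityMeasure (ν i)] {ε : ℝ} {Nm : ℕ}

theorem integrable_roundRegret (hμ : ∀ i, μ i ∈ Set.Icc (0 : ℝ) 1) {t : ℕ}
    (hK : (act t).card ≤ K) (P : Measure (ℕ → RoundSeed K M)) [IsFiniteMeasure P] :
    Integrable (fun ω => roundRegret T₀ T₁ act μ ω t) P :=
  Integrable.of_bound (measurable_roundRegret T₀ T₁ act μ t).aestronglyMeasurable K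
    (.of_forall fun ω => abs_roundRegret_le hμ hK ω)

theorem setIntegral_roundRegret_le (hμ : ∀ i, μ i ∈ Set.Icc (0 : ℝ) 1) {t : ℕ}
    (hK : (act t).card ≤ K) (G : Set (ℕ → RoundSeed K M)) :
    ∫ ω in G, roundRegret T₀ T₁ act μ ω t ∂(gameLaw M ν) ≤ K := by
  calc ∫ ω in G, roundRegret T₀ T₁ act μ ω t ∂(gameLaw M ν)
      ≤ ∫ _ in G, (K : ℝ) ∂(gameLaw M ν) :=
        integral_mono (integrable_roundRegret hμ hK _) (integrable_const _)
          fun ω => (abs_le.1 (abs_roundRegret_le hμ hK ω)).2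
    _ = (gameLaw M ν).real G * K := by simp
    _ ≤ 1 * K := by
        gcongr
        exact measureReal_le_one
    _ = K := one_mul _

/-- On `G` the regret is bounded by `K` times the number of unfixed players. This majorant is
nonnegative, so the restriction to `G` can be dropped after using it. Thus the dependence of `G` on
later epochs does not matter. -/
theorem IsQuiet.setIntegral_roundRegret_le {S : Finset (Fin M)} {m H : ℕ}
    (h : IsQuiet T₁ act S m H) (hμ : ∀ i, μ i ∈ Set.Icc (0 : ℝ) 1) (hT₀ : 0 < T₀)
    (hgap : GapsExceed ε Nm μ) (hS : S.card ≤ Nm) (hK : S.card ≤ K) (j : ℕ)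
    (hj : T₁ * m + T₀ + j < H) {G : Set (ℕ → RoundSeed K M)} (hGm : MeasurableSet G)
    (hG : G ⊆ learnsAt T₀ act ε μ S (T₁ * m)) :
    ∫ ω in G, roundRegret T₀ T₁ act μ ω (T₁ * m + T₀ + j) ∂(gameLaw M ν) ≤
      (K : ℝ) ^ 2 * (1 - Real.exp (-1) / K) ^ j := by
  set t := T₁ * m + T₀ + j with ht
  have hact : act t = S := h.act_eq t (by omega) hj
  have hU := fun p => measurableSet_unfixed (K := K) T₀ T₁ act ε μ S m t p
  have hc : 0 ≤ 1 - Real.exp (-1) / (K : ℝ) := by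
    rw [sub_nonneg]
    refine div_le_one_of_le₀ (le_trans ?_ (by exact_mod_cast NeZero.pos K : (1 : ℝ) ≤ K))
      (by positivity)
    exact Real.exp_le_one_iff.2 (by norm_num)
  have hint : Integrable (fun ω : ℕ → RoundSeed K M => ∑ p ∈ S,
      (unfixed T₀ T₁ act ε μ S m t p).indicator (fun _ => (K : ℝ)) ω) (gameLaw M ν) :=
    integrable_finsetSum _ fun p _ => (integrable_const (K : ℝ)).indicator (hU p)
  have hnn : ∀ ω : ℕ → RoundSeed K M, ∀ p ∈ S,
      0 ≤ (unfixed T₀ T₁ act ε μ S m t p).indicator (fun _ => (K : ℝ)) ω := fun ω p _ =>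
    Set.indicator_nonneg (fun _ _ => Nat.cast_nonneg K) ω
  calc ∫ ω in G, roundRegret T₀ T₁ act μ ω t ∂(gameLaw M ν)
      ≤ ∫ ω in G, ∑ p ∈ S, (unfixed T₀ T₁ act ε μ S m t p).indicator (fun _ => (K : ℝ)) ω
          ∂(gameLaw M ν) := by
        refine setIntegral_mono_on (integrable_roundRegret hμ (hact ▸ hK) _) hint.integrableOn
          hGm fun ω hω => ?_
        by_cases hall : ∀ p ∈ S, fixedArm T₀ T₁ act ω t p ≠ none
        · rw [h.roundRegret_eq_zero hT₀ hgap hS hK (hG hω) (by omega) hj hall]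
          exact Finset.sum_nonneg (hnn ω)
        · push Not at hall
          obtain ⟨p, hp, hpf⟩ := hall
          refine (abs_le.1 (abs_roundRegret_le hμ (hact ▸ hK) ω)).2.trans ?_
          refine le_trans ?_ (Finset.single_le_sum (hnn ω) hp)
          rw [Set.indicator_of_mem]
          exact ⟨hG hω, hpf⟩
    _ ≤ ∫ ω, ∑ p ∈ S, (unfixed T₀ T₁ act ε μ S m t p).indicator (fun _ => (K : ℝ)) ω
          ∂(gameLaw M ν) :=
        setIntegral_le_integral hint (.of_forall fun ω => Finset.sum_nonneg (hnn ω))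
    _ = ∑ p ∈ S, (gameLaw M ν).real (unfixed T₀ T₁ act ε μ S m t p) * K := by
        rw [integral_finsetSum _ fun p _ => (integrable_const (K : ℝ)).indicator (hU p)]
        refine Finset.sum_congr rfl fun p _ => ?_
        rw [integral_indicator_const _ (hU p), smul_eq_mul]
    _ ≤ ∑ _p ∈ S, (1 - Real.exp (-1) / (K : ℝ)) ^ j * K := by
        gcongr with p hp
        exact h.gameLaw_real_unfixed_le ν hT₀ hgap hS hK j hj hp
    _ = S.card * ((1 - Real.exp (-1) / (K : ℝ)) ^ j * K) := by simp
    _ ≤ K * ((1 - Real.exp (-1) / (K : ℝ)) ^ j * K) := by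
        gcongr
    _ = _ := by ring

/-- The bound for the expected regret in the `r`-th round of an epoch. -/
def roundBound (K T₀ : ℕ) (r : ℕ) : ℝ :=
  if r < T₀ then (K : ℝ) else (K : ℝ) ^ 2 * (1 - Real.exp (-1) / K) ^ (r - T₀)

theorem sum_geometric_le {c : ℝ} (hc0 : 0 < c) (hc1 : c ≤ 1) (n : ℕ) :
    ∑ j ∈ Finset.range n, (1 - c) ^ j ≤ 1 / c := by
  rw [le_div_iff₀' hc0]
  have h := mul_neg_geom_sum (1 - c) n
  rw [sub_sub_cancel] at h
  rw [h]
  have : 0 ≤ (1 - c) ^ n := pow_nonneg (by linarith) n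
  linarith

theorem sum_range_roundBound_le {T₀ T₁ : ℕ} (h : T₀ ≤ T₁) :
    ∑ r ∈ Finset.range T₁, roundBound K T₀ r ≤ K * T₀ + 3 * (K : ℝ) ^ 3 := by
  have hK1 : (1 : ℝ) ≤ K := by exact_mod_cast NeZero.pos K
  obtain ⟨k, rfl⟩ := Nat.exists_eq_add_of_le h
  have hc0 : 0 < Real.exp (-1) / (K : ℝ) := by positivity
  have hc1 : Real.exp (-1) / (K : ℝ) ≤ 1 :=
    div_le_one_of_le₀ (le_trans (Real.exp_le_one_iff.2 (by norm_num)) hK1) (by positivity)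
  rw [Finset.sum_range_add]
  refine add_le_add (le_of_eq ?_) ?_
  · have h1 : ∀ r ∈ Finset.range T₀, roundBound K T₀ r = K := fun r hr =>
      if_pos (Finset.mem_range.1 hr)
    rw [Finset.sum_congr rfl h1]
    simp [mul_comm]
  · have h1 : ∀ j ∈ Finset.range k, roundBound K T₀ (T₀ + j) =
        (K : ℝ) ^ 2 * (1 - Real.exp (-1) / K) ^ j := by
      intro j _
      rw [roundBound, if_neg (by omega), Nat.add_sub_cancel_left]
    rw [Finset.sum_congr rfl h1, ← Finset.mul_sum]
    have h2 := sum_geometric_le hc0 hc1 k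
    have h3 : 1 / (Real.exp (-1) / (K : ℝ)) ≤ 3 * K := by
      rw [Real.exp_neg, one_div_div, div_inv_eq_mul, mul_comm]
      have := Real.exp_one_lt_d9
      gcongr
      linarith
    calc _ ≤ (K : ℝ) ^ 2 * (3 * K) := by gcongr; exact h2.trans h3
      _ = _ := by ring

theorem roundBound_nonneg (K T₀ r : ℕ) : 0 ≤ roundBound K T₀ r := by
  unfold roundBound
  split_ifs
  · positivity
  · rcases Nat.eq_zero_or_pos K with rfl | hK
    · simp
    have : 0 ≤ 1 - Real.exp (-1) / (K : ℝ) := by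
      rw [sub_nonneg]
      refine div_le_one_of_le₀ (le_trans ?_ (by exact_mod_cast hK : (1 : ℝ) ≤ K)) (by positivity)
      exact Real.exp_le_one_iff.2 (by norm_num)
    positivity

theorem sum_range_mul_div_mod (f : ℕ → ℕ → ℝ) {d : ℕ} (n : ℕ) :
    ∑ t ∈ Finset.range (n * d), f (t / d) (t % d) =
      ∑ m ∈ Finset.range n, ∑ r ∈ Finset.range d, f m r := by
  induction n with
  | zero => simp
  | succ n ih =>
    rw [Nat.succ_mul, Finset.sum_range_add, ih, Finset.sum_range_succ]
    congr 1
    refine Finset.sum_congr rfl fun r hr => ?_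
    have hr' := Finset.mem_range.1 hr
    rw [Nat.mul_add_mod_of_lt hr', Nat.mul_comm, Nat.mul_add_div (by omega), Nat.div_eq_of_lt hr', add_zero]

end Regret

/-! # Epochs without a change of the set of players -/

section Alternating

variable {M : ℕ} {T L : ℕ} {init : Finset (Fin M)} {act : ℕ → Finset (Fin M)}

/-- The epochs in which the set of players may change before round `T`. -/
def changedEpochs (T L T₁ : ℕ) : Finset ℕ :=
  ((Finset.range T).filter (L ∣ ·)).image (· / T₁)

/-- Each changed epoch contains a multiple of `L` below `T`. -/
theorem card_changedEpochs_le (hL : 0 < L) (T₁ : ℕ) :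
    (changedEpochs T L T₁).card ≤ ⌈(T : ℝ) / L⌉₊ := by
  refine Finset.card_image_le.trans ?_
  rw [← Finset.card_range ⌈(T : ℝ) / L⌉₊]
  have hL' : (0 : ℝ) < L := by exact_mod_cast hL
  refine Finset.card_le_card_of_injOn (· / L) ?_ ?_
  · intro s hs
    obtain ⟨h1, k, rfl⟩ := Finset.mem_filter.1 hs
    rw [Finset.mem_range] at h1
    simp only [Finset.coe_range, Set.mem_Iio, Nat.mul_div_cancel_left k hL]
    rw [Nat.lt_ceil, lt_div_iff₀ hL']
    exact_mod_cast (mul_comm k L ▸ h1 : k * L < T)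
  · intro s hs s' hs' heq
    obtain ⟨k, rfl⟩ := (Finset.mem_filter.1 hs).2
    obtain ⟨k', rfl⟩ := (Finset.mem_filter.1 hs').2
    simp only [Nat.mul_div_cancel_left _ hL] at heq
    rw [heq]

theorem IsAlternating.isQuiet (h : IsAlternating T L init act) {T₁ m : ℕ}
    (hm : m ∉ changedEpochs T L T₁) :
    IsQuiet T₁ act (act (T₁ * m)) m (min T (T₁ * m + T₁)) where
  le := min_le_right _ _
  act_eq t h1 h2 := by
    induction t, h1 using Nat.le_induction with
    | base => rfl
    | succ t h1 ih =>
      rw [lt_min_iff] at h2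
      have hdvd : ¬ L ∣ t + 1 := by
        intro hdvd
        refine hm (Finset.mem_image.2 ⟨t + 1, by simp [h2.1, hdvd], ?_⟩)
        refine Nat.div_eq_of_lt_le (by rw [mul_comm]; omega) ?_
        rw [mul_comm, Nat.mul_add, mul_one]
        omega
      rw [h.stay (t + 1) h2.1 hdvd]
      exact ih (lt_min (by omega) (by omega))

end Alternating

/-! ### The total regret, summed over the epochs -/

section Total

variable {K M : ℕ} [NeZero K] {T₀ T₁ : ℕ} {act : ℕ → Finset (Fin M)} {μ : Fin K → ℝ}
  {ν : Fin K → Measure ℝ} [∀ i, IsProbabilityMeasure (ν i)] {ε : ℝ} {Nm T L : ℕ}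
  {init : Finset (Fin M)}

theorem setIntegral_regret_le (hμ : ∀ i, μ i ∈ Set.Icc (0 : ℝ) 1) (hT₀ : 0 < T₀) (hT₁ : T₀ < T₁)
    (hL : 0 < L) (halt : IsAlternating T L init act) (hcard : ∀ t < T, (act t).card ≤ Nm)
    (hNm : Nm < K) (hgap : GapsExceed ε Nm μ) :
    ∫ ω in learningSucceeds ε T₀ T₁ act μ T, regret T₀ T₁ act μ T ω ∂(gameLaw M ν) ≤
      ((T : ℝ) / T₁ + 1) * (K * T₀ + 3 * (K : ℝ) ^ 3) + K * T₁ * ⌈(T : ℝ) / L⌉₊ := by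
  set G : Set (ℕ → RoundSeed K M) := learningSucceeds ε T₀ T₁ act μ T with hG
  have hGm : MeasurableSet G := measurableSet_learningSucceeds ..
  have hK : ∀ t < T, (act t).card ≤ K := fun t ht => (hcard t ht).trans hNm.le
  have hT₁0 : 0 < T₁ := by omega
  -- The surcharge `K` for a changed epoch is added to the ordinary bound rather than replacing it,
  -- so the ordinary part is the same for all epochs.
  let b : ℕ → ℕ → ℝ := fun m r =>
    (if m ∈ changedEpochs T L T₁ then (K : ℝ) else 0) + roundBound K T₀ r
  have hb0 : ∀ m r, 0 ≤ b m r := fun m r => by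
    refine add_nonneg ?_ (roundBound_nonneg K T₀ r)
    split_ifs <;> positivity
  have hround : ∀ t < T, ∫ ω in G, roundRegret T₀ T₁ act μ ω t ∂(gameLaw M ν) ≤
      b (t / T₁) (t % T₁) := by
    intro t ht
    by_cases hch : t / T₁ ∈ changedEpochs T L T₁
    · refine (setIntegral_roundRegret_le hμ (hK t ht) G).trans ?_
      simp only [b, if_pos hch]
      linarith [roundBound_nonneg K T₀ (t % T₁)]
    simp only [b, if_neg hch, zero_add]
    have hdm := Nat.div_add_mod t T₁
    have hmod := Nat.mod_lt t hT₁0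
    by_cases hr : t % T₁ < T₀
    · rw [roundBound, if_pos hr]
      exact setIntegral_roundRegret_le hμ (hK t ht) G
    rw [roundBound, if_neg hr]
    have hq := halt.isQuiet hch
    have hstart : T₁ * (t / T₁) < T := by omega
    have hGsub : G ⊆ learnsAt T₀ act ε μ (act (T₁ * (t / T₁))) (T₁ * (t / T₁)) := by
      intro ω hω
      have h1 := hω (t / T₁) (by rw [mul_comm]; omega) fun s hs => by
        rw [Finset.mem_Ico, mul_comm] at hs
        rw [mul_comm]
        exact hq.act_eq s hs.1 (lt_min (by omega) (by omega))
      rwa [mul_comm] at h1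
    have := hq.setIntegral_roundRegret_le (ν := ν) hμ hT₀ hgap (hcard _ hstart) (hK _ hstart)
      (t % T₁ - T₀) (lt_min (by omega) (by omega)) hGm hGsub
    rwa [show T₁ * (t / T₁) + T₀ + (t % T₁ - T₀) = t by omega] at this
  have hTle : T ≤ (T / T₁ + 1) * T₁ := by
    have := Nat.lt_div_mul_add (a := T) hT₁0
    rw [Nat.succ_mul]
    omega
  have hK0 : (0 : ℝ) ≤ K := Nat.cast_nonneg K
  calc ∫ ω in G, regret T₀ T₁ act μ T ω ∂(gameLaw M ν)
      = ∑ t ∈ Finset.range T, ∫ ω in G, roundRegret T₀ T₁ act μ ω t ∂(gameLaw M ν) := by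
        simp only [regret_eq_sum_roundRegret]
        exact integral_finsetSum _ fun t ht =>
          integrable_roundRegret hμ (hK t (Finset.mem_range.1 ht)) _
    _ ≤ ∑ t ∈ Finset.range T, b (t / T₁) (t % T₁) :=
        Finset.sum_le_sum fun t ht => hround t (Finset.mem_range.1 ht)
    -- The horizon is rounded up to whole epochs, which is allowed because `b` is nonnegative.
    _ ≤ ∑ t ∈ Finset.range ((T / T₁ + 1) * T₁), b (t / T₁) (t % T₁) :=
        Finset.sum_le_sum_of_subset_of_nonneg (Finset.range_mono hTle) fun _ _ _ => hb0 _ _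
    _ = ∑ m ∈ Finset.range (T / T₁ + 1), ∑ r ∈ Finset.range T₁, b m r :=
        sum_range_mul_div_mod b _
    _ ≤ ∑ m ∈ Finset.range (T / T₁ + 1),
          ((if m ∈ changedEpochs T L T₁ then K * (T₁ : ℝ) else 0) +
            (K * T₀ + 3 * (K : ℝ) ^ 3)) := by
        refine Finset.sum_le_sum fun m _ => ?_
        simp only [b, Finset.sum_add_distrib]
        refine add_le_add (le_of_eq ?_) (sum_range_roundBound_le hT₁.le)
        split_ifs <;> simp [mul_comm]
    _ ≤ _ := by
        rw [Finset.sum_add_distrib, add_comm]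
        refine add_le_add ?_ ?_
        · rw [Finset.sum_const, Finset.card_range, nsmul_eq_mul]
          push_cast
          gcongr
          exact Nat.cast_div_le
        · rw [← Finset.sum_filter, Finset.sum_const, nsmul_eq_mul, mul_comm]
          refine mul_le_mul_of_nonneg_left ?_ (by positivity)
          refine Nat.cast_le.2 (le_trans (Finset.card_le_card fun m hm => ?_)
            (card_changedEpochs_le hL T₁))
          exact (Finset.mem_filter.1 hm).2

end Total


/-! # The parameters -/

section Parameters

variable {K T : ℕ} {ε δ l : ℝ}

theorem one_le_log_four_mul_div (hδ : 0 < δ) (hδ1 : δ < 1) (hT : 1 ≤ T) :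
    1 ≤ Real.log (4 * T / δ) := by
  have hT' : (1 : ℝ) ≤ T := by exact_mod_cast hT
  rw [Real.le_log_iff_exp_le (by positivity), le_div_iff₀ hδ]
  have h1 := Real.exp_one_lt_d9
  have h2 := Real.exp_pos 1
  nlinarith

theorem log_ranking_eq (hδ : 0 < δ) (hT : 1 ≤ T) :
    4 * (K : ℝ) ^ 2 / (δ / (2 * T)) = 8 * (K : ℝ) ^ 2 * T / δ := by
  have : (T : ℝ) ≠ 0 := by positivity
  field_simp
  ring

theorem le_learningRounds_ranking (hδ : 0 < δ) (hT : 1 ≤ T) :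
    16 * (K : ℝ) / ε ^ 2 * Real.log (8 * (K : ℝ) ^ 2 * T / δ) ≤ learningRounds K ε δ T := by
  rw [← log_ranking_eq hδ hT]
  exact le_trans (le_trans (le_max_right _ _) (le_max_left _ _)) (Nat.le_ceil _)

theorem le_learningRounds_estimate :
    50 * (K : ℝ) ^ 2 * Real.log (4 * T / δ) ≤ learningRounds K ε δ T := by
  refine le_trans (le_of_eq ?_) (le_trans (le_max_right _ _) (Nat.le_ceil _))
  ring

theorem le_learningRounds [NeZero K] (hδ : 0 < δ) (hδ1 : δ < 1) (hT : 1 ≤ T) :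
    K ≤ learningRounds K ε δ T := by
  have hK1 : (1 : ℝ) ≤ K := by exact_mod_cast NeZero.pos K
  have h1 := one_le_log_four_mul_div hδ hδ1 hT
  have h2 : (K : ℝ) ≤ learningRounds K ε δ T := by
    refine le_trans ?_ le_learningRounds_estimate
    calc (K : ℝ) ≤ 50 * (K : ℝ) ^ 2 * 1 := by nlinarith
      _ ≤ _ := by gcongr
  exact_mod_cast h2

theorem learningRounds_le [NeZero K] (hε : 0 < ε) (hε1 : ε ≤ 1) (hδ : 0 < δ) (hδ1 : δ < 1)
    (hT : 1 ≤ T) : (learningRounds K ε δ T : ℝ) ≤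
      151 * ((K : ℝ) / ε) ^ 2 * (1 + Real.log T + Real.log (1 / δ)) := by
  have hK1 : (1 : ℝ) ≤ K := by exact_mod_cast NeZero.pos K
  have hT' : (1 : ℝ) ≤ T := by exact_mod_cast hT
  have hlT : 0 ≤ Real.log T := Real.log_nonneg hT'
  have hlδ : 0 ≤ Real.log (1 / δ) := Real.log_nonneg (by rw [le_div_iff₀ hδ]; linarith)
  set Λ := 1 + Real.log T + Real.log (1 / δ) with hΛ
  have hΛ1 : 1 ≤ Λ := by linarith
  have hlK : Real.log K ≤ K := (Real.log_le_sub_one_of_pos (by linarith)).trans (by linarith)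
  have hl8 : Real.log 8 ≤ 3 := by
    rw [show (8 : ℝ) = 2 ^ 3 by norm_num, Real.log_pow]
    have := Real.log_two_lt_d9
    norm_num
    linarith
  have hl4 : Real.log 4 ≤ 3 := (Real.log_le_log (by norm_num) (by norm_num)).trans hl8
  have hsplit : ∀ a : ℝ, 0 < a → Real.log (a * T / δ) = Real.log a + (Λ - 1) := by
    intro a ha
    rw [hΛ, mul_div_assoc, Real.log_mul ha.ne' (by positivity), div_eq_mul_one_div (T : ℝ),
      Real.log_mul (by positivity) (by positivity)]
    ring
  have hK2 : Real.log (8 * (K : ℝ) ^ 2 * T / δ) ≤ 6 * K * Λ := by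
    rw [hsplit _ (by positivity), Real.log_mul (by norm_num) (by positivity), Real.log_pow]
    push_cast
    nlinarith
  have hK4 : Real.log (4 * (K : ℝ) ^ 2 * T / δ) ≤ 6 * K * Λ := by
    refine le_trans (Real.log_le_log (by positivity) ?_) hK2
    gcongr
    norm_num
  have h4 : Real.log (4 * T / δ) ≤ 3 * Λ := by
    rw [hsplit _ (by norm_num)]
    linarith
  have hκ : (K : ℝ) ^ 2 ≤ ((K : ℝ) / ε) ^ 2 := by
    gcongr
    exact le_div_self (by linarith) hε hε1
  have hmain : max
    (max ((K : ℝ) / 2 * Real.log (2 * (K : ℝ) ^ 2 / (δ / (2 * T))))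
      (16 * (K : ℝ) / ε ^ 2 * Real.log (4 * (K : ℝ) ^ 2 / (δ / (2 * T)))))
    ((K : ℝ) ^ 2 * Real.log (4 * T / δ) / 0.02) ≤ 150 * ((K : ℝ) / ε) ^ 2 * Λ := by
    refine max_le (max_le ?_ ?_) ?_
    · have h : 2 * (K : ℝ) ^ 2 / (δ / (2 * T)) = 4 * (K : ℝ) ^ 2 * T / δ := by
        field_simp
        ring
      rw [h]
      calc (K : ℝ) / 2 * Real.log (4 * (K : ℝ) ^ 2 * T / δ) ≤ (K : ℝ) / 2 * (6 * K * Λ) := by gcongr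
        _ = 3 * (K : ℝ) ^ 2 * Λ := by ring
        _ ≤ 150 * ((K : ℝ) / ε) ^ 2 * Λ := by gcongr; norm_num
    · rw [log_ranking_eq hδ hT]
      calc 16 * (K : ℝ) / ε ^ 2 * Real.log (8 * (K : ℝ) ^ 2 * T / δ)
          ≤ 16 * (K : ℝ) / ε ^ 2 * (6 * K * Λ) := by gcongr
        _ = 96 * ((K : ℝ) / ε) ^ 2 * Λ := by
          field_simp
          ring
        _ ≤ 150 * ((K : ℝ) / ε) ^ 2 * Λ := by gcongr; norm_num
    · calc (K : ℝ) ^ 2 * Real.log (4 * T / δ) / 0.02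
          = 50 * (K : ℝ) ^ 2 * Real.log (4 * T / δ) := by ring
        _ ≤ 50 * ((K : ℝ) / ε) ^ 2 * (3 * Λ) := by
          gcongr
          exact zero_le_one.trans (one_le_log_four_mul_div hδ hδ1 hT)
        _ = _ := by ring
  have hone : 1 ≤ ((K : ℝ) / ε) ^ 2 * Λ :=
    one_le_mul_of_one_le_of_one_le (le_trans (one_le_pow₀ hK1) hκ) hΛ1
  calc (learningRounds K ε δ T : ℝ) ≤ 150 * ((K : ℝ) / ε) ^ 2 * Λ + 1 := by
        refine (Nat.ceil_lt_add_one ?_).le.trans (by linarith)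
        refine le_trans ?_ (le_max_right _ _)
        have := one_le_log_four_mul_div hδ hδ1 hT
        positivity
    _ ≤ _ := by linarith

theorem one_le_period (hT : 1 ≤ T) : 1 ≤ period T l :=
  Nat.one_le_iff_ne_zero.2 (Nat.ceil_pos.2 (Real.rpow_pos_of_pos (by exact_mod_cast hT) l)).ne'

theorem ceil_div_period_le (hT : 1 ≤ T) (hl1 : l < 1) :
    (⌈(T : ℝ) / period T l⌉₊ : ℝ) ≤ 2 * (T : ℝ) ^ (1 - l) := by
  have hT' : (1 : ℝ) ≤ T := by exact_mod_cast hT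
  have hT0 : (0 : ℝ) < T := by linarith
  have h1 : (T : ℝ) / period T l ≤ (T : ℝ) ^ (1 - l) := by
    rw [Real.rpow_sub hT0, Real.rpow_one]
    exact div_le_div_of_nonneg_left hT0.le (Real.rpow_pos_of_pos hT0 l) (Nat.le_ceil _)
  have h2 : 1 ≤ (T : ℝ) ^ (1 - l) := Real.one_le_rpow hT' (by linarith)
  have h3 := (Nat.ceil_lt_add_one (show 0 ≤ (T : ℝ) / period T l by positivity)).le
  linarith

/-- With `B = T₀ + 2e²K` and `s = √(T B / x)`, one has `T/s ≤ √(T x)` and `x s ≤ √(T x) B`, while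
`√(T x) ≤ 2 T^(1-l/2)` because `x ≤ 2 T^(1-l)`. The epoch length exceeds `s` by at most `T₀ + 2`,
and `x (T₀ + 2)` is of no larger order since `T^(1-l) ≤ T^(1-l/2)`. The constant is `7 * 151 + 43`.
-/
theorem epochLength_tradeoff [NeZero K] (hε : 0 < ε) (hε1 : ε ≤ 1) (hδ : 0 < δ) (hδ1 : δ < 1)
    (hT : 1 ≤ T) (hl0 : 0 < l) (hl1 : l < 1) :
    ((T : ℝ) / epochLength K ε δ T l + 1) * (K * learningRounds K ε δ T + 3 * (K : ℝ) ^ 3) +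
      K * epochLength K ε δ T l * ⌈(T : ℝ) / period T l⌉₊ ≤
      1100 * ((K : ℝ) / ε) ^ 3 * (1 + Real.log T + Real.log (1 / δ)) * (T : ℝ) ^ (1 - l / 2) := by
  have hK1 : (1 : ℝ) ≤ K := by exact_mod_cast NeZero.pos K
  have hT' : (1 : ℝ) ≤ T := by exact_mod_cast hT
  have hT0 : (0 : ℝ) < T := by linarith
  have hlT : 0 ≤ Real.log T := Real.log_nonneg hT'
  have hlδ : 0 ≤ Real.log (1 / δ) := Real.log_nonneg (by rw [le_div_iff₀ hδ]; linarith)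
  have hA := learningRounds_le (K := K) hε hε1 hδ hδ1 hT
  have hx2 := ceil_div_period_le hT hl1
  have hTE : max
    ⌈√((T : ℝ) * (learningRounds K ε δ T + 2 * (Real.exp 2 * K)) / ⌈(T : ℝ) / period T l⌉₊)⌉₊
    (learningRounds K ε δ T + 1) = epochLength K ε δ T l := rfl
  have hL1 := one_le_period (l := l) hT
  have hx1 : (1 : ℝ) ≤ ⌈(T : ℝ) / period T l⌉₊ := by
    have hL0 : (0 : ℝ) < period T l := by exact_mod_cast hL1
    exact_mod_cast Nat.ceil_pos.2 (div_pos hT0 hL0)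
  set Λ := 1 + Real.log T + Real.log (1 / δ) with hΛ
  set A : ℕ := learningRounds K ε δ T
  set E : ℕ := epochLength K ε δ T l
  set x : ℕ := ⌈(T : ℝ) / period T l⌉₊
  set κ := (K : ℝ) / ε with hκ
  set W := (T : ℝ) ^ (1 - l / 2) with hW
  have hΛ1 : 1 ≤ Λ := by linarith
  have hKκ : (K : ℝ) ≤ κ := le_div_self (by linarith) hε hε1
  have hκ1 : 1 ≤ κ := hK1.trans hKκ
  have hW1 : 1 ≤ W := Real.one_le_rpow hT' (by linarith)
  have hVW : (T : ℝ) ^ (1 - l) ≤ W := Real.rpow_le_rpow_of_exponent_le hT' (by linarith)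
  have hW2 : W ^ 2 = T * (T : ℝ) ^ (1 - l) := by
    rw [hW, ← Real.rpow_natCast, ← Real.rpow_mul hT0.le]
    nth_rw 2 [← Real.rpow_one (T : ℝ)]
    rw [← Real.rpow_add hT0]
    congr 1
    push_cast
    ring
  have hA0 : (0 : ℝ) ≤ A := Nat.cast_nonneg A
  have he2 : Real.exp 2 ≤ 15 / 2 := by
    rw [show (2 : ℝ) = 1 + 1 by norm_num, Real.exp_add]
    have h1 := Real.exp_one_lt_d9
    have h2 := Real.exp_pos 1
    nlinarith
  have he1 : 1 ≤ Real.exp 2 := Real.one_le_exp (by norm_num)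
  set B : ℝ := A + 2 * (Real.exp 2 * K) with hB
  have hB1 : 1 ≤ B := by nlinarith
  have hB2 : B ≤ A + 15 * K := by nlinarith
  set s := √((T : ℝ) * B / x) with hs
  have hx0 : (0 : ℝ) < x := by linarith
  have hs0 : 0 < s := Real.sqrt_pos.2 (by positivity)
  have hs2 : s ^ 2 = T * B / x := Real.sq_sqrt (by positivity)
  have hr : √((T : ℝ) * x) ^ 2 = T * x := Real.sq_sqrt (by positivity)
  set r := √((T : ℝ) * x) with hrdef
  have hr0 : 0 ≤ r := Real.sqrt_nonneg _
  have hrW : r ≤ 2 * W := by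
    refine le_of_sq_le_sq ?_ (by positivity)
    rw [hr, mul_pow, hW2]
    have : (T : ℝ) * x ≤ T * (2 * (T : ℝ) ^ (1 - l)) := by gcongr
    have h0 : 0 ≤ T * (T : ℝ) ^ (1 - l) := by positivity
    linarith
  have hsE : s ≤ E := by
    rw [← hTE]
    push_cast
    exact le_trans (Nat.le_ceil _) (le_max_left _ _)
  have hEs : (E : ℝ) ≤ s + A + 2 := by
    rw [← hTE]
    push_cast
    refine max_le ?_ ?_
    · linarith [(Nat.ceil_lt_add_one hs0.le).le]
    · linarith
  have hTE' : (T : ℝ) / E ≤ 2 * W := by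
    refine le_trans ?_ hrW
    refine (div_le_div_of_nonneg_left hT0.le hs0 hsE).trans ?_
    rw [div_le_iff₀ hs0]
    refine le_of_sq_le_sq ?_ (by positivity)
    rw [mul_pow, hr, hs2]
    have : (T : ℝ) * x * (T * B / x) = T ^ 2 * B := by
      field_simp
    rw [this]
    exact le_mul_of_one_le_right (by positivity) hB1
  have hxs : x * s ≤ 2 * W * B := by
    refine le_trans ?_ (mul_le_mul_of_nonneg_right hrW (by linarith))
    refine le_of_sq_le_sq ?_ (by positivity)
    rw [mul_pow, mul_pow, hr, hs2]
    have : (x : ℝ) ^ 2 * (T * B / x) = T * x * B := by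
      field_simp
    rw [this]
    have : B ≤ B ^ 2 := by nlinarith
    gcongr
  have hxE : E * (x : ℝ) ≤ 2 * W * (A + 15 * K) + 2 * W * (A + 2) := by
    calc E * (x : ℝ) ≤ (s + A + 2) * x := by gcongr
      _ = x * s + x * (A + 2) := by ring
      _ ≤ 2 * W * B + (2 * W) * (A + 2) := by
        gcongr
        linarith
      _ ≤ _ := by gcongr
  have hKA : K * (A : ℝ) ≤ 151 * κ ^ 3 * Λ := by
    calc K * (A : ℝ) ≤ κ * (151 * κ ^ 2 * Λ) := by gcongr
      _ = _ := by ring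
  have hκ3 : (K : ℝ) ^ 3 ≤ κ ^ 3 * Λ :=
    le_trans (by gcongr) (le_mul_of_one_le_right (by positivity) hΛ1)
  have hK2 : (K : ℝ) ^ 2 ≤ (K : ℝ) ^ 3 := pow_le_pow_right₀ hK1 (by norm_num)
  have hK3 : (K : ℝ) ≤ (K : ℝ) ^ 3 := le_self_pow₀ hK1 (by norm_num)
  have hW0 : 0 ≤ W := by linarith
  calc ((T : ℝ) / E + 1) * (K * A + 3 * (K : ℝ) ^ 3) + K * E * x
      ≤ (2 * W + W) * (K * A + 3 * (K : ℝ) ^ 3) +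
          K * (2 * W * (A + 15 * K) + 2 * W * (A + 2)) := by
        rw [mul_assoc (K : ℝ)]
        gcongr
    _ = W * (7 * (K * A) + 9 * (K : ℝ) ^ 3 + 30 * (K : ℝ) ^ 2 + 4 * K) := by ring
    _ ≤ W * (7 * (151 * κ ^ 3 * Λ) + 43 * (κ ^ 3 * Λ)) := by
        refine mul_le_mul_of_nonneg_left ?_ hW0
        linarith
    _ = _ := by ring

end Parameters

/-! # The probability that the learning succeeds -/

section Success

variable {K M : ℕ} [NeZero K] {ν : Fin K → Measure ℝ} [∀ i, IsProbabilityMeasure (ν i)]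
  {T T₁ Nm : ℕ} {ε δ : ℝ} {act : ℕ → Finset (Fin M)}

/-- Union bound over fewer than `T + 1` epochs. The parameter `T₀` makes a ranking error have
probability at most of order `δ/(K² T)` per arm and player. For the estimate it gives `(δ/(4T))²`,
whose square absorbs the number of players, as `K ≤ T₀ ≤ T` whenever some learning phase fits into
the horizon. -/
theorem gameLaw_real_compl_learningSucceeds_le (hν : ∀ i, ∀ᵐ x ∂(ν i), x ∈ Set.Icc (0 : ℝ) 1)
    (hε : 0 < ε) (hε1 : ε ≤ 1) (hδ : 0 < δ) (hδ1 : δ < 1) (hT : 1 ≤ T)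
    (hcard : ∀ t < T, (act t).card ≤ Nm) (hNm : Nm < K) (hT₁ : learningRounds K ε δ T < T₁) :
    (gameLaw M ν).real
      (learningSucceeds ε (learningRounds K ε δ T) T₁ act (meanReward ν) T)ᶜ ≤ δ / 2 := by
  classical
  have hK0 : (0 : ℝ) < K := by exact_mod_cast NeZero.pos K
  have hT' : (1 : ℝ) ≤ T := by exact_mod_cast hT
  have hA1 := le_learningRounds_ranking (K := K) (ε := ε) hδ hT
  have hA2 := le_learningRounds_estimate (K := K) (T := T) (ε := ε) (δ := δ)
  have hA3 := le_learningRounds (K := K) (ε := ε) hδ hδ1 hT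
  have hlog := one_le_log_four_mul_div hδ hδ1 hT
  have hlog8 : 0 ≤ Real.log (8 * (K : ℝ) ^ 2 * T / δ) := by
    refine Real.log_nonneg ?_
    rw [one_le_div hδ]
    have : (1 : ℝ) ≤ K := by exact_mod_cast NeZero.pos K
    nlinarith [one_le_pow₀ (n := 2) this]
  set T₀ := learningRounds K ε δ T
  have hT₀ : 0 < T₀ := lt_of_lt_of_le (NeZero.pos K) hA3
  rcases lt_or_ge T T₀ with hlt | hge
  -- If `T < T₀`, no epoch completes its learning and the event imposes no condition.
  · have : learningSucceeds ε T₀ T₁ act (meanReward ν) T = Set.univ := by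
      refine Set.eq_univ_of_forall fun ω m hm => ?_
      omega
    rw [this, Set.compl_univ, measureReal_empty]
    positivity
  have hexp1 : Real.exp (-(T₀ * ε ^ 2 / (9 * K))) ≤ δ / (8 * (K : ℝ) ^ 2 * T) := by
    rw [← Real.le_log_iff_exp_le (by positivity), ← inv_div _ δ, Real.log_inv, neg_le_neg_iff,
      le_div_iff₀ (by positivity)]
    have h : 16 * (K : ℝ) * Real.log (8 * (K : ℝ) ^ 2 * T / δ) ≤ T₀ * ε ^ 2 := by
      rw [← div_le_iff₀ (by positivity)]
      refine le_trans (le_of_eq ?_) hA1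
      ring
    nlinarith [mul_nonneg hK0.le hlog8]
  have hexp2 : Real.exp (-(T₀ / (18 * (K : ℝ) ^ 2))) ≤ (δ / (4 * T)) ^ 2 := by
    rw [← Real.le_log_iff_exp_le (by positivity), Real.log_pow, ← inv_div _ δ, Real.log_inv]
    push_cast
    rw [mul_neg, neg_le_neg_iff, le_div_iff₀ (by positivity)]
    nlinarith [mul_nonneg (sq_nonneg (K : ℝ)) (zero_le_one.trans hlog)]
  have hKT : (K : ℝ) ≤ T := by exact_mod_cast hA3.trans hge
  have hsub : (learningSucceeds ε T₀ T₁ act (meanReward ν) T)ᶜ ⊆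
      ⋃ m ∈ (Finset.range T).filter fun m => m * T₁ + T₀ ≤ T ∧
        ∀ t ∈ Finset.Ico (m * T₁) (m * T₁ + T₀), act t = act (m * T₁),
      (learnsAt T₀ act ε (meanReward ν) (act (m * T₁)) (m * T₁))ᶜ := by
    intro ω hω
    rw [learningSucceeds_eq_iInter] at hω
    simp only [Set.mem_compl_iff, Set.mem_iInter, not_forall] at hω
    obtain ⟨m, hm1, hm2, hm3⟩ := hω
    simp only [Set.mem_iUnion]
    have hle : m ≤ m * T₁ := Nat.le_mul_of_pos_right m (by omega)
    exact ⟨m, Finset.mem_filter.2 ⟨Finset.mem_range.2 (by omega), hm1, hm2⟩, hm3⟩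
  calc _ ≤ _ := measureReal_mono hsub (measure_ne_top _ _)
    _ ≤ _ := measureReal_biUnion_finset_le _ _
    _ ≤ ∑ _m ∈ (Finset.range T).filter fun m => m * T₁ + T₀ ≤ T ∧
        ∀ t ∈ Finset.Ico (m * T₁) (m * T₁ + T₀), act t = act (m * T₁),
        (K * (K * (2 * (δ / (8 * (K : ℝ) ^ 2 * T))) + 2 * (δ / (4 * T)) ^ 2) : ℝ) := by
      refine Finset.sum_le_sum fun m hm => ?_
      obtain ⟨-, hm1, hm2⟩ := Finset.mem_filter.1 hm
      refine (gameLaw_real_compl_learnsAt_le ν hν hε hε1 hT₀ hm2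
        ((hcard _ (by omega)).trans_lt hNm)).trans ?_
      gcongr
    _ ≤ T * (K * (K * (2 * (δ / (8 * (K : ℝ) ^ 2 * T))) + 2 * (δ / (4 * T)) ^ 2)) := by
      rw [Finset.sum_const, nsmul_eq_mul]
      refine mul_le_mul_of_nonneg_right ?_ (by positivity)
      have := Finset.card_filter_le (Finset.range T) fun m => m * T₁ + T₀ ≤ T ∧
        ∀ t ∈ Finset.Ico (m * T₁) (m * T₁ + T₀), act t = act (m * T₁)
      rw [Finset.card_range] at this
      exact_mod_cast this
    _ = δ / 4 + K / T * δ ^ 2 / 8 := by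
      field_simp
      ring
    _ ≤ δ / 4 + 1 * δ / 8 := by
      gcongr
      · exact div_le_one_of_le₀ hKT (by positivity)
      · nlinarith
    _ ≤ δ / 2 := by linarith

end Success

/-! # Departures in the MEGA bound -/

section Mega

/-- Only the later half of the departures is kept: with `n = ⌊T/(2L)⌋ ≥ 2`, there are at least `n/2
≥ T/(8L)` of them, at rounds no earlier than `L(n-1) ≥ T/8`. -/
theorem le_megaDepartures {β : ℝ} (hβ : 0 ≤ β) {T L : ℕ} (hL : 0 < L) (hLT : 4 * L ≤ T) :
    (T : ℝ) / (8 * L) * ((T : ℝ) / 8) ^ β ≤ megaDepartures β T L := by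
  have hL' : (0 : ℝ) < L := by exact_mod_cast hL
  have hLT' : 4 * (L : ℝ) ≤ T := by exact_mod_cast hLT
  set n := T / (2 * L) with hn
  have hn2 : 2 ≤ n := (Nat.le_div_iff_mul_le (by omega)).2 (by omega)
  have hnT : 2 * L * n ≤ T := Nat.mul_div_le _ _
  have hTn : T < 2 * L * (n + 1) := Nat.lt_mul_div_succ T (by omega)
  have hTn' : (T : ℝ) < 2 * L * (n + 1) := by exact_mod_cast hTn
  have hn2' : (2 : ℝ) ≤ n := by exact_mod_cast hn2
  have hinj : Set.InjOn (2 * L * ·) (Finset.Ico (n / 2) n : Set ℕ) := by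
    intro a _ b _ h
    exact Nat.eq_of_mul_eq_mul_left (by omega) h
  have hsub : (Finset.Ico (n / 2) n).image (2 * L * ·) ⊆
      (Finset.range T).filter (fun t => 2 * L ∣ t) := by
    intro t ht
    obtain ⟨a, ha, rfl⟩ := Finset.mem_image.1 ht
    rw [Finset.mem_filter, Finset.mem_range]
    refine ⟨lt_of_lt_of_le ?_ hnT, dvd_mul_right _ _⟩
    exact Nat.mul_lt_mul_of_pos_left (Finset.mem_Ico.1 ha).2 (by omega)
  have hcard : (T : ℝ) / (8 * L) ≤ (Finset.Ico (n / 2) n).card := by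
    rw [Nat.card_Ico, Nat.cast_sub (Nat.div_le_self _ _), div_le_iff₀ (by positivity)]
    have : ((n / 2 : ℕ) : ℝ) ≤ n / 2 := Nat.cast_div_le
    nlinarith
  calc (T : ℝ) / (8 * L) * ((T : ℝ) / 8) ^ β
      ≤ (Finset.Ico (n / 2) n).card * ((T : ℝ) / 8) ^ β := by gcongr
    _ = ∑ _r ∈ Finset.Ico (n / 2) n, ((T : ℝ) / 8) ^ β := by simp
    _ ≤ ∑ r ∈ Finset.Ico (n / 2) n, ((2 * L * r : ℕ) : ℝ) ^ β := by
        refine Finset.sum_le_sum fun r hr => ?_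
        have h1 : n ≤ 2 * r + 1 := by
          have := (Finset.mem_Ico.1 hr).1
          omega
        have h1' : (n : ℝ) ≤ 2 * r + 1 := by exact_mod_cast h1
        refine Real.rpow_le_rpow (by positivity) ?_ hβ
        push_cast
        nlinarith
    _ = ∑ t ∈ (Finset.Ico (n / 2) n).image (2 * L * ·), (t : ℝ) ^ β :=
        (Finset.sum_image (f := fun t : ℕ => (t : ℝ) ^ β) hinj).symm
    _ ≤ megaDepartures β T L :=
        Finset.sum_le_sum_of_subset_of_nonneg hsub fun _ _ _ => by positivity

theorem exists_le_megaBound (β : ℝ) (hβ : 0 ≤ β) : ∃ c : ℝ, 0 < c ∧ ∀ l : ℝ, β < l → l < 1 →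
    ∃ T₂ : ℕ, ∀ T : ℕ, T₂ ≤ T → ∀ other : ℝ, 0 ≤ other →
      c * (T : ℝ) ^ (1 - (l - β)) ≤ megaBound β T (period T l) other := by
  have h8 : (1 : ℝ) ≤ 8 ^ β := Real.one_le_rpow (by norm_num) hβ
  -- The factor 16 is the 8 of `le_megaDepartures` times the 2 in `L ≤ 2 T^l`; `8 ^ β` comes from
  -- `(T/8)^β`. The threshold `T^(1-l) ≥ 8` below ensures `4L ≤ T`.
  refine ⟨1 / (16 * 8 ^ β), by positivity, fun l hl hl1 => ?_⟩
  have htend : Filter.Tendsto (fun T : ℕ => (T : ℝ) ^ (1 - l)) Filter.atTop Filter.atTop :=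
    (tendsto_rpow_atTop (by linarith)).comp tendsto_natCast_atTop_atTop
  obtain ⟨T₂, hT₂⟩ := Filter.eventually_atTop.1
    ((htend.eventually_ge_atTop 8).and (Filter.eventually_ge_atTop 1))
  refine ⟨T₂, fun T hT other hother => ?_⟩
  obtain ⟨h1, hT1⟩ := hT₂ T hT
  have hT' : (1 : ℝ) ≤ T := by exact_mod_cast hT1
  have hT0 : (0 : ℝ) < T := by linarith
  have hTl : 1 ≤ (T : ℝ) ^ l := Real.one_le_rpow hT' (by linarith)
  have hmul : (T : ℝ) ^ (1 - l) * (T : ℝ) ^ l = T := by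
    rw [← Real.rpow_add hT0, sub_add_cancel, Real.rpow_one]
  have hL : (period T l : ℝ) ≤ 2 * (T : ℝ) ^ l := by
    have := (Nat.ceil_lt_add_one (zero_le_one.trans hTl)).le
    simp only [period]
    linarith
  have hL1 := one_le_period (l := l) hT1
  have hL1' : (1 : ℝ) ≤ period T l := by exact_mod_cast hL1
  have hLT : 4 * period T l ≤ T := by
    have : 4 * (period T l : ℝ) ≤ T := by nlinarith
    exact_mod_cast this
  refine le_min ?_ (le_trans ?_ (le_add_of_nonneg_left hother))
  · have h2 : (T : ℝ) ^ (1 - (l - β)) ≤ T := by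
      calc (T : ℝ) ^ (1 - (l - β)) ≤ (T : ℝ) ^ (1 : ℝ) :=
            Real.rpow_le_rpow_of_exponent_le hT' (by linarith)
        _ = T := Real.rpow_one _
    have h3 : 1 / (16 * (8 : ℝ) ^ β) ≤ 1 := by
      rw [div_le_one (by positivity)]
      linarith
    calc 1 / (16 * (8 : ℝ) ^ β) * (T : ℝ) ^ (1 - (l - β)) ≤ 1 * T := by gcongr
      _ = T := one_mul _
  · refine le_trans ?_ (le_megaDepartures hβ hL1 hLT)
    have h2 : (T : ℝ) ^ (1 - (l - β)) = T / (T : ℝ) ^ l * (T : ℝ) ^ β := by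
      rw [show 1 - (l - β) = (1 - l) + β by ring, Real.rpow_add hT0, Real.rpow_sub hT0,
        Real.rpow_one]
    rw [h2, Real.div_rpow hT0.le (by norm_num)]
    calc 1 / (16 * (8 : ℝ) ^ β) * (T / (T : ℝ) ^ l * (T : ℝ) ^ β)
        = T / (8 * (2 * (T : ℝ) ^ l)) * ((T : ℝ) ^ β / 8 ^ β) := by
          field_simp
          norm_num
      _ ≤ T / (8 * period T l) * ((T : ℝ) ^ β / 8 ^ β) := by gcongr

end Mega

/-! # The regret of the algorithm given that the learning succeeds -/

section Conditional

variable {K M : ℕ} [NeZero K] {ν : Fin K → Measure ℝ} [∀ i, IsProbabilityMeasure (ν i)]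
  {T T₀ T₁ Nm : ℕ} {ε δ l : ℝ} {act : ℕ → Finset (Fin M)} {init : Finset (Fin M)}

theorem regret_eq_zero_of_no_players {μ : Fin K → ℝ} (h : ∀ t < T, (act t).card ≤ 0) :
    regret T₀ T₁ act μ T = fun _ => 0 := by
  funext ω
  rw [regret_eq_sum_roundRegret]
  refine Finset.sum_eq_zero fun t ht => ?_
  have : act t = ∅ := Finset.card_eq_zero.1 (Nat.le_zero.1 (h t (Finset.mem_range.1 ht)))
  simp [roundRegret, this]

theorem learningSucceeds_eq_univ_of_no_players {μ : Fin K → ℝ} (hT₀ : 0 < T₀)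
    (h : ∀ t < T, (act t).card ≤ 0) :
    learningSucceeds ε T₀ T₁ act μ T = Set.univ := by
  refine Set.eq_univ_of_forall fun ω m hm _ p hp => ?_
  have := h (m * T₁) (by omega)
  rw [Nat.le_zero, Finset.card_eq_zero] at this
  rw [this] at hp
  exact absurd hp (Finset.notMem_empty p)

theorem integral_cond_eq {Ω : Type*} [MeasurableSpace Ω] (P : Measure Ω) (G : Set Ω) (f : Ω → ℝ) :
    ∫ ω, f ω ∂(P[|G]) = (P.real G)⁻¹ * ∫ ω in G, f ω ∂P := by
  rw [ProbabilityTheory.cond, integral_smul_measure, ENNReal.toReal_inv, smul_eq_mul]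
  rfl

theorem integral_regret_cond_le (hν : ∀ i, ∀ᵐ x ∂(ν i), x ∈ Set.Icc (0 : ℝ) 1)
    (hε : 0 < ε) (hδ : 0 < δ) (hδ1 : δ < 1) (hl0 : 0 < l) (hl1 : l < 1) (hT : 1 ≤ T)
    (halt : IsAlternating T (period T l) init act) (hcard : ∀ t < T, (act t).card ≤ Nm)
    (hNm0 : 0 < Nm) (hNm : Nm < K) (hgap : GapsExceed ε Nm (meanReward ν))
    (hT₀ : T₀ = learningRounds K ε δ T) (hT₁ : T₁ = epochLength K ε δ T l) :
    1 - δ ≤ (gameLaw M ν).real (learningSucceeds ε T₀ T₁ act (meanReward ν) T) ∧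
      ∫ ω, regret T₀ T₁ act (meanReward ν) T ω
        ∂((gameLaw M ν)[|learningSucceeds ε T₀ T₁ act (meanReward ν) T]) ≤
        2200 * ((K : ℝ) / ε) ^ 3 * (1 + Real.log T + Real.log (1 / δ)) *
          (T : ℝ) ^ (1 - l / 2) := by
  have hμ := meanReward_mem_Icc hν
  have hε1 := hgap.le_one hμ hNm0 hNm
  have hlt : T₀ < T₁ := by
    rw [hT₀, hT₁]
    exact Nat.lt_of_succ_le (le_max_right _ _)
  have hpos : 0 < T₀ := hT₀ ▸ lt_of_lt_of_le (NeZero.pos K) (le_learningRounds hδ hδ1 hT)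
  have hfail := gameLaw_real_compl_learningSucceeds_le (M := M) hν hε hε1 hδ hδ1 hT hcard hNm
    (hT₀ ▸ hlt)
  rw [← hT₀, probReal_compl_eq_one_sub (measurableSet_learningSucceeds ..)] at hfail
  have hreg := setIntegral_regret_le (ν := ν) hμ hpos hlt (one_le_period hT) halt hcard hNm hgap
  have htrade := epochLength_tradeoff (K := K) hε hε1 hδ hδ1 hT hl0 hl1
  rw [← hT₀, ← hT₁] at htrade
  refine ⟨by linarith, ?_⟩
  rw [integral_cond_eq]
  set q := (gameLaw M ν).real (learningSucceeds ε T₀ T₁ act (meanReward ν) T)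
  -- This needs failure probability `δ/2`, not merely `δ`; it doubles 1100 to 2200.
  have hq : 1 / 2 ≤ q := by linarith
  have hΛ : 0 ≤ 1 + Real.log T + Real.log (1 / δ) := by
    have h1 : 0 ≤ Real.log T := Real.log_nonneg (by exact_mod_cast hT)
    have h2 : 0 ≤ Real.log (1 / δ) := Real.log_nonneg (by rw [le_div_iff₀ hδ]; linarith)
    linarith
  rw [inv_mul_le_iff₀ (by linarith)]
  refine (hreg.trans htrade).trans ?_
  have hR : 0 ≤ 2200 * ((K : ℝ) / ε) ^ 3 * (1 + Real.log T + Real.log (1 / δ)) *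
      (T : ℝ) ^ (1 - l / 2) := by positivity
  calc _ = 1 / 2 * (2200 * ((K : ℝ) / ε) ^ 3 * (1 + Real.log T + Real.log (1 / δ)) *
      (T : ℝ) ^ (1 - l / 2)) := by ring
    _ ≤ _ := by gcongr

end Conditional

end

end MusicalChairs

/-! ### The theorem -/

theorem theorem4 :
    (∀ β : ℝ, 0 ≤ β → ∃ c : ℝ, 0 < c ∧ ∀ l : ℝ, β < l → l < 1 →
      ∃ T₂ : ℕ, ∀ T : ℕ, T₂ ≤ T → ∀ other : ℝ, 0 ≤ other →
        c * (T : ℝ) ^ (1 - (l - β)) ≤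
          MusicalChairs.megaBound β T (MusicalChairs.period T l) other) ∧
    (∃ (C : ℝ) (a b : ℕ), ∀ l : ℝ, 0 < l → l < 1 →
      ∀ (K : ℕ) [NeZero K] (ν : Fin K → Measure ℝ) [∀ i, IsProbabilityMeasure (ν i)],
        (∀ i, ∀ᵐ x ∂(ν i), x ∈ Set.Icc (0 : ℝ) 1) →
      ∀ (ε δ : ℝ), 0 < ε → 0 < δ → δ < 1 →
      ∀ (T M Nm : ℕ) (init : Finset (Fin M)) (act : ℕ → Finset (Fin M)), 1 ≤ T →
        MusicalChairs.IsAlternating T (MusicalChairs.period T l) init act →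
        (∀ t < T, (act t).card ≤ Nm) → Nm < K →
        MusicalChairs.GapsExceed ε Nm (MusicalChairs.meanReward ν) →
      ∀ (T₀ T₁ : ℕ), T₀ = MusicalChairs.learningRounds K ε δ T →
        T₁ = MusicalChairs.epochLength K ε δ T l →
      ∀ (P : Measure (ℕ → MusicalChairs.RoundSeed K M)), P = MusicalChairs.gameLaw M ν →
      ∀ (G : Set (ℕ → MusicalChairs.RoundSeed K M)),
        G = MusicalChairs.learningSucceeds ε T₀ T₁ act (MusicalChairs.meanReward ν) T →
      ∀ (R : (ℕ → MusicalChairs.RoundSeed K M) → ℝ),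
        R = MusicalChairs.regret T₀ T₁ act (MusicalChairs.meanReward ν) T →
        MeasurableSet G ∧ 1 - δ ≤ P.real G ∧ Integrable R (P[|G]) ∧
          ∫ ω, R ω ∂(P[|G]) ≤
            C * ((K : ℝ) / ε) ^ a * (1 + Real.log T + Real.log (1 / δ)) ^ b *
              (T : ℝ) ^ (1 - l / 2)) := by
  refine ⟨MusicalChairs.exists_le_megaBound, 2200, 3, 1, ?_⟩
  intro l hl0 hl1 K _ ν _ hν ε δ hε hδ hδ1 T M Nm init act hT halt hcard hNm hgap T₀ T₁ hT₀ hT₁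
    P hP G hG R hR
  subst hP hG hR
  have hGm := MusicalChairs.measurableSet_learningSucceeds (K := K) T₀ T₁ act ε
    (MusicalChairs.meanReward ν) T
  have hint : Integrable (MusicalChairs.regret T₀ T₁ act (MusicalChairs.meanReward ν) T)
      ((MusicalChairs.gameLaw M ν)[|MusicalChairs.learningSucceeds ε T₀ T₁ act
        (MusicalChairs.meanReward ν) T]) :=
    integrable_finsetSum _ fun t ht => MusicalChairs.integrable_roundRegret
      (MusicalChairs.meanReward_mem_Icc hν) ((hcard t (Finset.mem_range.1 ht)).trans hNm.le) _
  rw [pow_one]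
  -- For `Nm = 0` the gap condition is empty, so `ε ≤ 1` is not available; but then nobody is
  -- present and the regret vanishes.
  rcases Nat.eq_zero_or_pos Nm with rfl | hNm0
  · have hpos : 0 < T₀ :=
      hT₀ ▸ lt_of_lt_of_le (NeZero.pos K) (MusicalChairs.le_learningRounds hδ hδ1 hT)
    refine ⟨hGm, ?_, hint, ?_⟩
    · rw [MusicalChairs.learningSucceeds_eq_univ_of_no_players hpos hcard, probReal_univ]
      linarith
    · rw [MusicalChairs.regret_eq_zero_of_no_players hcard, integral_zero]
      have h1 : 0 ≤ Real.log T := Real.log_nonneg (by exact_mod_cast hT)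
      have h2 : 0 ≤ Real.log (1 / δ) := Real.log_nonneg (by rw [le_div_iff₀ hδ]; linarith)
      positivity
  · obtain ⟨h1, h2⟩ := MusicalChairs.integral_regret_cond_le (M := M) hν hε hδ hδ1 hl0 hl1 hT halt
      hcard hNm0 hNm hgap hT₀ hT₁
    exact ⟨hGm, h1, hint, h2⟩
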